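/- Let $n\ge 1$ and let $F:\mathbb R\to\mathbb R$ be admissible on $\mathbb R$, that is, strictly increasing and continuous. Let $f_F$ be the inverse function of $F$ on $J_F:=F(\mathbb R)$. For a function $\phi:\mathbb R^n\to\mathbb R$ bounded from below, set $$[e^{t\Delta}\phi](x):=\int_{\mathbb R^n}(4\pi t)^{-n/2}\exp\Bigl(-\frac{|x-y|^2}{4t}\Bigr)\phi(y)\,\mathrm dy\quad(t>0),$$ and let $T(\phi)\in[0,\infty]$ be the maximal existence time of $e^{t\Delta}\phi$, i.e. the largest $T$ such that this integral converges absolutely for all $t\in(0,T)$ and $x\in\mathbb R^n$. A function $\phi:\mathbb R^n\to\mathbb R$ is called $F$-convex if $F(\phi)$ is convex on $\mathbb R^n$. We say that $F$-convexity is preserved under the heat flow if, for every $F$-convex function $\phi$ on $\mathbb R^n$ that is bounded from below and satisfies $T(\phi)>0$, the function $e^{t\Delta}\phi$ is $F$-convex for all $t\in(0,T(\phi))$. We say that $F$-convexity is only trivially preserved under the heat flow if every $F$-convex function $\phi$ on $\mathbb R^n$ that is bounded from below, satisfies $T(\phi)>0$, and is such that $e^{t\Delta}\phi$ is $F$-convex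 for all $t\in(0,T(\phi))$, is constant. Then the following hold. (1) If $\lim_{r\to\infty}F(r)<\infty$, then $F$-convexity is only trivially preserved under the heat flow. (2) If $\lim_{r\to\infty}F(r)=\infty$ and $$\int_{F(1)}^\infty e^{-Az^2}f_F(z)\,\mathrm dz=\infty\quad\text{for any }A>0,$$ then $F$-convexity is only trivially preserved under the heat flow. (3) Let $F\in C^2(\mathbb R)$ and $\lim_{r\to\infty}F(r)=\infty$, and assume that $$\int_{F(1)}^\infty e^{-Az^2}f_F(z)\,\mathrm dz<\infty\quad\text{for some }A>0.$$ Then $F$-convexity is preserved under the heat flow if and only if $F'>0$ on $\mathbb R$ and $g_F:=(\log f_F')'$ is convex on $J_F$. -/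

import Mathlib

open Set Filter Topology MeasureTheory
open scoped ENNReal

noncomputable section

namespace HeatFConvex

/-- Euclidean space `ℝⁿ`. -/
abbrev E (n : ℕ) : Type := EuclideanSpace ℝ (Fin n)

/-- The Gauss kernel `Γ_n(x,t) = (4πt)^{-n/2} exp(-|x|²/(4t))`, for `t > 0`. -/
def gaussKernel (n : ℕ) (x : E n) (t : ℝ) : ℝ :=
  (4 * Real.pi * t) ^ (-(n : ℝ) / 2) * Real.exp (-‖x‖ ^ 2 / (4 * t))

/-- The heat flow `[e^{tΔ}φ](x)`, for `t ≥ 0`; it is `φ` itself at `t = 0`. -/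
def heatFlow {n : ℕ} (φ : E n → ℝ) (t : ℝ) (x : E n) : ℝ :=
  if t = 0 then φ x else ∫ y, gaussKernel n (x - y) t * φ y

/-- The maximal existence time `T(φ) ∈ [0,∞]` of `e^{tΔ}φ`: the largest `T` such that the
integral defining `[e^{tΔ}φ](x)` converges for all `t ∈ (0,T)` and all `x`. -/
def existenceTime {n : ℕ} (φ : E n → ℝ) : ℝ≥0∞ :=
  sSup {T : ℝ≥0∞ | ∀ t : ℝ, 0 < t → ENNReal.ofReal t < T →
    ∀ x : E n, Integrable (fun y => gaussKernel n (x - y) t * φ y)}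

/-- Admissible functions on `ℝ`. -/
structure Admissible (F : ℝ → ℝ) : Prop where
  strictMono : StrictMono F
  continuous : Continuous F

/-- `J_F = F(ℝ)`. -/
def imageSet (F : ℝ → ℝ) : Set ℝ := range F

/-- `f_F`, the inverse function of `F`; only its values on `J_F` are meaningful. -/
def inverse (F : ℝ → ℝ) : ℝ → ℝ := Function.invFun F

/-- `g_F = (log f_F')'`. -/
def logDerivInverse (F : ℝ → ℝ) : ℝ → ℝ :=
  deriv (fun z => Real.log (deriv (inverse F) z))

/-- `φ` is `F`-convex: `F(φ)` is convex on `ℝⁿ`. -/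
def FConvex {n : ℕ} (F : ℝ → ℝ) (φ : E n → ℝ) : Prop :=
  ConvexOn ℝ univ (fun x => F (φ x))

/-- `φ` is bounded from below on `ℝⁿ`. -/
def BoundedBelow {n : ℕ} (φ : E n → ℝ) : Prop := BddBelow (range φ)

/-- `F`-convexity is preserved under the heat flow on `ℝⁿ` (initial data bounded from below). -/
def Preserved (n : ℕ) (F : ℝ → ℝ) : Prop :=
  ∀ φ : E n → ℝ, BoundedBelow φ → FConvex F φ → 0 < existenceTime φ →
    ∀ t : ℝ, 0 < t → ENNReal.ofReal t < existenceTime φ → FConvex F (heatFlow φ t)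

/-- `F`-convexity is only trivially preserved under the heat flow on `ℝⁿ`
(initial data bounded from below). -/
def OnlyTriviallyPreserved (n : ℕ) (F : ℝ → ℝ) : Prop :=
  ∀ φ : E n → ℝ, BoundedBelow φ → FConvex F φ → 0 < existenceTime φ →
    (∀ t : ℝ, 0 < t → ENNReal.ofReal t < existenceTime φ → FConvex F (heatFlow φ t)) →
    ∃ c : ℝ, ∀ x, φ x = c

/-- `∫_{F(1)}^∞ e^{-A z²} f_F(z) dz ∈ [0,∞]`. When `F(r) → ∞` as `r → ∞`, the interval
`[F(1),∞)` lies in `J_F` and `f_F ≥ 1` on it, so the integrand is positive. -/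
def gaussIntegral (F : ℝ → ℝ) (A : ℝ) : ℝ≥0∞ :=
  ∫⁻ z in Ici (F 1), ENNReal.ofReal (Real.exp (-A * z ^ 2) * inverse F z)

end HeatFConvex

end

/-!
For a solution `u` of the heat equation, `v = F(u)` solves `v_t = Δv + g_F(v) |∇v|²`.

Sufficiency. On the line, convexity of `g_F` yields a maximum principle, by doubling of variables,
for the defect `v(l x + m y) - l v₀(x) - m v₁(y)` of three solutions with bounded Lipschitz data: at
a positive maximum the three slopes agree, and the defect of `g_F` at the three values is bounded
by a multiple of that of `v`. The resulting three-function inequality tensorizes to `ℝⁿ` by Fubini,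
one coordinate at a time, and general data are reached from below by truncation and infimal
convolution of `F ∘ φ`.

Necessity. Let the data be `f_F(max(x₁, c))`. At `x₁ = s > c` the right derivative of `F(e^{tΔ}φ)`
at `t = 0` is `g_F(s)`, whereas the value at `t = 0` is affine in `s`; hence `g_F` is convex. If
`F'` vanished somewhere, `log f_F'` would tend to `∞` at a finite point from the right, which is
impossible because a convex function is bounded below on a bounded interval.

Triviality. A convex function bounded above is constant. If `φ` is not constant on a line parallel
to an axis, then `F ∘ φ` grows at least linearly along it and the Gaussian integral of `φ` there
dominates `∫ e^{-Az²} f_F(z) dz` for some `A > 0`. When all the latter diverge, the former diverges,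
which Fubini excludes on almost every such line, and continuity on the others.
-/

open Set Filter Topology MeasureTheory ProbabilityTheory
open scoped ENNReal NNReal

noncomputable section

namespace HeatFConvex

/-! ### The heat flow as a Gaussian average -/

theorem pi_withDensity_ofReal {ι : Type*} [Fintype ι] (μ : Measure ℝ) [SigmaFinite μ]
    (p : ℝ → ℝ) (hp : Integrable p μ) (hp0 : ∀ x, 0 ≤ p x) :
    Measure.pi (fun _ : ι => μ.withDensity fun x => ENNReal.ofReal (p x)) =
      (Measure.pi fun _ : ι => μ).withDensity fun x => ENNReal.ofReal (∏ i, p (x i)) := by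
  have : IsFiniteMeasure (μ.withDensity fun x => ENNReal.ofReal (p x)) :=
    isFiniteMeasure_withDensity_ofReal hp.2
  refine Measure.pi_eq fun s hs => ?_
  rw [withDensity_apply _ (MeasurableSet.univ_pi hs), Measure.restrict_pi_pi,
    ← ofReal_integral_eq_lintegral_ofReal (Integrable.fintype_prod fun i => hp.restrict)
      (ae_of_all _ fun x => Finset.prod_nonneg fun i _ => hp0 _),
    integral_fintype_prod_eq_prod (fun (_ : ι) => p),
    ENNReal.ofReal_prod_of_nonneg fun i _ => integral_nonneg hp0]
  refine Finset.prod_congr rfl fun i _ => ?_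
  rw [withDensity_apply _ (hs i),
    ofReal_integral_eq_lintegral_ofReal hp.restrict (ae_of_all _ hp0)]

/-- The centred Gaussian measure on `ℝ` whose density is the one-dimensional heat kernel at
time `t`; it is the Dirac mass at `0` for `t ≤ 0`. -/
def heatMeasure (t : ℝ) : Measure ℝ := gaussianReal 0 (2 * t).toNNReal

instance (t : ℝ) : IsProbabilityMeasure (heatMeasure t) := by
  unfold heatMeasure; infer_instance

/-- The centred Gaussian measure on `ℝⁿ` whose density is the heat kernel at time `t`. It lives on
`Fin n → ℝ` rather than on `E n` so that the product structure is available. -/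
def heatMeasurePi (n : ℕ) (t : ℝ) : Measure (Fin n → ℝ) := Measure.pi fun _ => heatMeasure t

instance (n : ℕ) (t : ℝ) : IsProbabilityMeasure (heatMeasurePi n t) := by
  unfold heatMeasurePi; infer_instance

theorem toNNReal_two_mul_ne_zero {t : ℝ} (ht : 0 < t) : (2 * t).toNNReal ≠ 0 :=
  (Real.toNNReal_pos.2 (by linarith)).ne'

theorem gaussKernel_toLp {n : ℕ} {t : ℝ} (ht : 0 < t) (z : Fin n → ℝ) :
    gaussKernel n (WithLp.toLp 2 z) t = ∏ i, gaussianPDFReal 0 (2 * t).toNNReal (z i) := by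
  have h2 : (((2 * t).toNNReal : ℝ≥0) : ℝ) = 2 * t := Real.coe_toNNReal _ (by linarith)
  simp only [gaussKernel, gaussianPDFReal, h2, Finset.prod_mul_distrib, Finset.prod_const,
    Finset.card_univ, Fintype.card_fin, sub_zero]
  congr 1
  · have hpos : 0 < 4 * Real.pi * t := by positivity
    rw [show 2 * Real.pi * (2 * t) = 4 * Real.pi * t by ring, inv_pow, Real.sqrt_eq_rpow,
      ← Real.rpow_natCast, ← Real.rpow_mul hpos.le, neg_div, Real.rpow_neg hpos.le]
    ring_nf
  · rw [← Real.exp_sum, EuclideanSpace.norm_sq_eq]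
    congr 1
    simp only [Real.norm_eq_abs, sq_abs, neg_div, Finset.sum_neg_distrib, Finset.sum_div]
    exact congrArg Neg.neg (Finset.sum_congr rfl fun i _ => by ring)

theorem heatMeasurePi_eq_withDensity {n : ℕ} {t : ℝ} (ht : 0 < t) :
    heatMeasurePi n t = (volume : Measure (Fin n → ℝ)).withDensity
      fun z => ENNReal.ofReal (gaussKernel n (WithLp.toLp 2 z) t) := by
  simp_rw [gaussKernel_toLp ht]
  unfold heatMeasurePi heatMeasure
  rw [gaussianReal_of_var_ne_zero _ (toNNReal_two_mul_ne_zero ht)]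
  exact pi_withDensity_ofReal volume _ (integrable_gaussianPDFReal _ _) (gaussianPDFReal_nonneg _ _)

theorem gaussKernel_nonneg {n : ℕ} {t : ℝ} (ht : 0 < t) (x : E n) : 0 ≤ gaussKernel n x t := by
  unfold gaussKernel; positivity

theorem measurable_ofReal_gaussKernel_toLp (n : ℕ) (t : ℝ) :
    Measurable fun z : Fin n → ℝ => ENNReal.ofReal (gaussKernel n (WithLp.toLp 2 z) t) := by
  unfold gaussKernel
  have : Measurable fun z : Fin n → ℝ => (WithLp.toLp 2 z : E n) :=
    (PiLp.continuous_toLp 2 _).measurable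
  fun_prop

theorem gaussKernel_neg {n : ℕ} (t : ℝ) (x : E n) : gaussKernel n (-x) t = gaussKernel n x t := by
  simp [gaussKernel]

theorem integrable_gaussKernel_iff {n : ℕ} {t : ℝ} (ht : 0 < t) (φ : E n → ℝ) (x : E n) :
    Integrable (fun y => gaussKernel n (x - y) t * φ y) ↔
      Integrable (fun z => φ (x + WithLp.toLp 2 z)) (heatMeasurePi n t) := by
  rw [heatMeasurePi_eq_withDensity ht, integrable_withDensity_iff_integrable_smul'
    (measurable_ofReal_gaussKernel_toLp n t) (ae_of_all _ fun _ => ENNReal.ofReal_lt_top),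
    ← (measurePreserving_add_left (volume : Measure (E n)) x).integrable_comp_emb
      (MeasurableEquiv.addLeft x).measurableEmbedding,
    ← (PiLp.volume_preserving_toLp (Fin n)).integrable_comp_emb
      (MeasurableEquiv.toLp 2 (Fin n → ℝ)).measurableEmbedding]
  refine integrable_congr (ae_of_all _ fun z => ?_)
  simp [Function.comp_def, ENNReal.toReal_ofReal (gaussKernel_nonneg ht _), gaussKernel_neg]

theorem heatFlow_eq_integral {n : ℕ} {t : ℝ} (ht : 0 < t) (φ : E n → ℝ) (x : E n) :
    heatFlow φ t x = ∫ z, φ (x + WithLp.toLp 2 z) ∂(heatMeasurePi n t) := by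
  rw [heatFlow, if_neg ht.ne', heatMeasurePi_eq_withDensity ht,
    integral_withDensity_eq_integral_toReal_smul
    (measurable_ofReal_gaussKernel_toLp n t) (ae_of_all _ fun _ => ENNReal.ofReal_lt_top),
    ← (measurePreserving_add_left (volume : Measure (E n)) x).integral_comp
      (MeasurableEquiv.addLeft x).measurableEmbedding,
    ← (PiLp.volume_preserving_toLp (Fin n)).integral_comp
      (MeasurableEquiv.toLp 2 (Fin n → ℝ)).measurableEmbedding]
  refine integral_congr_ae (ae_of_all _ fun z => ?_)
  simp [ENNReal.toReal_ofReal (gaussKernel_nonneg ht _), gaussKernel_neg]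

theorem integrable_of_lt_existenceTime {n : ℕ} {φ : E n → ℝ} {t : ℝ} (ht : 0 < t)
    (h : ENNReal.ofReal t < existenceTime φ) (x : E n) :
    Integrable (fun z => φ (x + WithLp.toLp 2 z)) (heatMeasurePi n t) := by
  obtain ⟨T, hT, htT⟩ := lt_sSup_iff.1 h
  exact (integrable_gaussKernel_iff ht φ x).1 (hT t ht htT x)

theorem exists_pos_ofReal_lt {T : ℝ≥0∞} (h : 0 < T) : ∃ t : ℝ, 0 < t ∧ ENNReal.ofReal t < T := by
  obtain ⟨t, -, h0, hT⟩ := ENNReal.lt_iff_exists_real_btwn.1 h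
  exact ⟨t, ENNReal.ofReal_pos.1 h0, hT⟩

/-! ### The one-dimensional heat flow -/

/-- The one-dimensional heat flow of `φ`; being defined through `heatMeasure`, it takes the initial
value `φ` at `t = 0`. -/
def lineFlow (φ : ℝ → ℝ) (t y : ℝ) : ℝ := ∫ z, φ (y + z) ∂(heatMeasure t)

theorem heatMeasure_eq_map {t : ℝ} (ht : 0 ≤ t) :
    heatMeasure t = (gaussianReal 0 1).map (Real.sqrt (2 * t) * ·) := by
  have h2 : (0 : ℝ) ≤ 2 * t := by linarith
  have hvar : (2 * t).toNNReal = NNReal.mk (Real.sqrt (2 * t) ^ 2) (sq_nonneg _) * 1 := by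
    ext
    rw [mul_one, Real.coe_toNNReal _ h2]
    exact (Real.sq_sqrt h2).symm
  rw [gaussianReal_map_const_mul, heatMeasure, hvar, mul_zero]

theorem lineFlow_eq_integral_sqrt {φ : ℝ → ℝ} (hφ : Measurable φ) {t : ℝ} (ht : 0 ≤ t) (y : ℝ) :
    lineFlow φ t y = ∫ z, φ (y + Real.sqrt (2 * t) * z) ∂(gaussianReal 0 1) := by
  rw [lineFlow, heatMeasure_eq_map ht, integral_map (by fun_prop)]
  exact (hφ.comp (measurable_const_add y)).aestronglyMeasurable

theorem lineFlow_zero {φ : ℝ → ℝ} (hφ : Measurable φ) (y : ℝ) : lineFlow φ 0 y = φ y := by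
  simp [lineFlow_eq_integral_sqrt hφ le_rfl]

theorem continuousOn_lineFlow {φ : ℝ → ℝ} (hφ : Continuous φ) {B : ℝ} (hB : ∀ x, |φ x| ≤ B) :
    ContinuousOn (fun p : ℝ × ℝ => lineFlow φ p.1 p.2) {p | 0 ≤ p.1} := by
  have h : Continuous fun p : ℝ × ℝ =>
      ∫ z, φ (p.2 + Real.sqrt (2 * p.1) * z) ∂(gaussianReal 0 1) :=
    continuous_of_dominated (bound := fun _ => B)
      (fun p => (hφ.comp (by fun_prop)).aestronglyMeasurable)
      (fun p => ae_of_all _ fun z => hB _) (integrable_const _)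
      (ae_of_all _ fun z => hφ.comp (by fun_prop))
  exact h.continuousOn.congr fun p hp => lineFlow_eq_integral_sqrt hφ.measurable hp _

theorem integrable_comp_add_of_bdd {φ : ℝ → ℝ} (hφ : Measurable φ) {B : ℝ} (hB : ∀ x, |φ x| ≤ B)
    (μ : Measure ℝ) [IsFiniteMeasure μ] (y : ℝ) : Integrable (fun z => φ (y + z)) μ :=
  Integrable.of_bound (hφ.comp (measurable_const_add y)).aestronglyMeasurable B
    (ae_of_all _ fun _ => hB _)

theorem lineFlow_mem_Icc {φ : ℝ → ℝ} {α β : ℝ} (hφ : Measurable φ) (hαβ : ∀ x, φ x ∈ Icc α β)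
    (t y : ℝ) : lineFlow φ t y ∈ Icc α β :=
  (convex_Icc α β).integral_mem isClosed_Icc (ae_of_all _ fun _ => hαβ _)
    (integrable_comp_add_of_bdd hφ (fun x => abs_le_max_abs_abs (hαβ x).1 (hαβ x).2) _ y)

theorem lipschitzWith_integral {X Ω : Type*} [PseudoMetricSpace X] [MeasurableSpace Ω]
    {μ : Measure Ω} [IsProbabilityMeasure μ] {f : X → Ω → ℝ} {L : ℝ≥0}
    (hint : ∀ x, Integrable (f x) μ) (hf : ∀ ω, LipschitzWith L fun x => f x ω) :
    LipschitzWith L fun x => ∫ ω, f x ω ∂μ := by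
  refine LipschitzWith.of_dist_le_mul fun x y => ?_
  have hle : ∀ ω, ‖f x ω - f y ω‖ ≤ L * dist x y := fun ω => by
    rw [← dist_eq_norm]
    exact (hf ω).dist_le_mul x y
  rw [dist_eq_norm, ← integral_sub (hint x) (hint y)]
  simpa using norm_integral_le_of_norm_le_const (ae_of_all μ hle)

theorem lipschitzWith_lineFlow {φ : ℝ → ℝ} {L : ℝ≥0} (hφ : LipschitzWith L φ) {B : ℝ}
    (hB : ∀ x, |φ x| ≤ B) (t : ℝ) : LipschitzWith L (lineFlow φ t) :=
  lipschitzWith_integral (integrable_comp_add_of_bdd hφ.continuous.measurable hB _) fun z =>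
    LipschitzWith.of_dist_le_mul fun y y' => by
      simpa only [dist_add_right] using hφ.dist_le_mul (y + z) (y' + z)

/-- The unnormalized heat kernel times a monomial, `x^k e^{-x²/(4t)}`. All derivatives of the heat
kernel are combinations of these. -/
def momentKernel (k : ℕ) (t x : ℝ) : ℝ := x ^ k * Real.exp (-(1 / (4 * t)) * x ^ 2)

theorem measurable_momentKernel (k : ℕ) (t : ℝ) : Measurable (momentKernel k t) := by
  unfold momentKernel; fun_prop

theorem hasDerivAt_momentKernel (k : ℕ) (t x : ℝ) :
    HasDerivAt (momentKernel k t)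
      (k * momentKernel (k - 1) t x - 1 / (2 * t) * momentKernel (k + 1) t x) x := by
  refine ((hasDerivAt_pow k x).mul
    (((hasDerivAt_pow 2 x).const_mul (-(1 / (4 * t)))).exp)).congr_deriv ?_
  simp only [momentKernel]
  field_simp
  ring

theorem hasDerivAt_momentKernel_time (k : ℕ) {t : ℝ} (ht : t ≠ 0) (x : ℝ) :
    HasDerivAt (fun s => momentKernel k s x) (1 / (4 * t ^ 2) * momentKernel (k + 2) t x) t := by
  have hexponent : HasDerivAt (fun s : ℝ => -(1 / (4 * s)) * x ^ 2)
      (1 / (4 * t ^ 2) * x ^ 2) t := by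
    have := ((hasDerivAt_inv ht).const_mul (-(1 / 4) : ℝ)).mul_const (x ^ 2)
    refine (this.congr_deriv (by field_simp)).congr_of_eventuallyEq (.of_forall fun s => ?_)
    simp only [one_div, mul_inv]; ring
  exact (hexponent.exp.const_mul (x ^ k)).congr_deriv (by simp only [momentKernel]; ring)

/-- A common integrable majorant of `momentKernel k s (x - h)` for `s` near `t` and `h` near `0`. -/
def momentMajorant (k : ℕ) (t x : ℝ) : ℝ := (1 + |x|) ^ k * Real.exp (-(1 / (8 * t)) * x ^ 2)

theorem integrable_momentMajorant (k : ℕ) {t : ℝ} (ht : 0 < t) :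
    Integrable (momentMajorant k t) := by
  have hc : 0 < 1 / (8 * t) := by positivity
  have h0 : Integrable fun x : ℝ => Real.exp (-(1 / (8 * t)) * x ^ 2) :=
    integrable_exp_neg_mul_sq hc
  have hk : Integrable fun x : ℝ => |x| ^ k * Real.exp (-(1 / (8 * t)) * x ^ 2) := by
    refine (integrable_rpow_mul_exp_neg_mul_sq hc (s := (k : ℝ))
      (neg_one_lt_zero.trans_le k.cast_nonneg)).norm.congr (ae_of_all _ fun x => ?_)
    simp [Real.rpow_natCast]
  unfold momentMajorant
  refine ((h0.add hk).const_mul (2 ^ (k - 1))).mono' (by fun_prop) (ae_of_all _ fun x => ?_)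
  rw [Real.norm_of_nonneg (by positivity)]
  calc (1 + |x|) ^ k * Real.exp (-(1 / (8 * t)) * x ^ 2)
      ≤ (2 ^ (k - 1) * (1 ^ k + |x| ^ k)) * Real.exp (-(1 / (8 * t)) * x ^ 2) := by
        gcongr; exact add_pow_le zero_le_one (abs_nonneg x) k
    _ = _ := by simp only [one_pow, Pi.add_apply]; ring

theorem abs_momentKernel_shift_le (k : ℕ) {t : ℝ} (ht : 0 < t) {h : ℝ} (hh : |h| ≤ 1) (x : ℝ) :
    |momentKernel k t (x - h)| ≤ 2 ^ k * Real.exp (1 / (4 * t)) * momentMajorant k t x := by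
  rw [momentKernel, momentMajorant, abs_mul, abs_pow, Real.abs_exp]
  have hbase : |x - h| ≤ 2 * (1 + |x|) := by linarith [abs_sub x h, abs_nonneg x]
  have hexp : Real.exp (-(1 / (4 * t)) * (x - h) ^ 2) ≤
      Real.exp (1 / (4 * t)) * Real.exp (-(1 / (8 * t)) * x ^ 2) := by
    rw [← Real.exp_add, Real.exp_le_exp,
      show 1 / (4 * t) = 2 * (1 / (8 * t)) by field_simp; norm_num]
    have hsq : x ^ 2 ≤ 2 * (x - h) ^ 2 + 2 := by
      nlinarith [sq_nonneg (x - 2 * h), (sq_le_one_iff_abs_le_one h).2 hh]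
    nlinarith [show 0 < 1 / (8 * t) by positivity]
  calc |x - h| ^ k * Real.exp (-(1 / (4 * t)) * (x - h) ^ 2)
      ≤ (2 * (1 + |x|)) ^ k * (Real.exp (1 / (4 * t)) * Real.exp (-(1 / (8 * t)) * x ^ 2)) := by
        gcongr
    _ = _ := by rw [mul_pow]; ring

theorem abs_momentKernel_le_of_le_two_mul (k : ℕ) {s t : ℝ} (hs : 0 < s) (hst : s ≤ 2 * t)
    (x : ℝ) : |momentKernel k s x| ≤ momentMajorant k t x := by
  rw [momentKernel, momentMajorant, abs_mul, abs_pow, Real.abs_exp]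
  have : 1 / (8 * t) ≤ 1 / (4 * s) := one_div_le_one_div_of_le (by positivity) (by linarith)
  gcongr
  linarith

/-- The Gaussian moments `∫ (z - y)^k e^{-(z-y)²/(4t)} φ(z) dz`. -/
def heatMoment (φ : ℝ → ℝ) (k : ℕ) (t y : ℝ) : ℝ := ∫ z, momentKernel k t (z - y) * φ z

section BoundedData

variable {φ : ℝ → ℝ} {B : ℝ} {t : ℝ}

theorem integrable_momentKernel_mul (hφ : Measurable φ) (hB : ∀ x, |φ x| ≤ B) (k : ℕ)
    (ht : 0 < t) (y : ℝ) : Integrable fun z => momentKernel k t (z - y) * φ z := by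
  have hmeas := measurable_momentKernel k t
  refine (((integrable_momentMajorant k ht).comp_sub_right y).mul_const B).mono' (by fun_prop)
    (ae_of_all _ fun z => ?_)
  rw [norm_mul, Real.norm_eq_abs, Real.norm_eq_abs]
  exact mul_le_mul (abs_momentKernel_le_of_le_two_mul k ht (by linarith) _) (hB z)
    (abs_nonneg _) ((abs_nonneg _).trans (abs_momentKernel_le_of_le_two_mul k ht (by linarith) _))

theorem hasDerivAt_heatMoment (hφ : Measurable φ) (hB : ∀ x, |φ x| ≤ B) (k : ℕ) (ht : 0 < t)
    (y : ℝ) :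
    HasDerivAt (heatMoment φ k t)
      (-k * heatMoment φ (k - 1) t y + 1 / (2 * t) * heatMoment φ (k + 1) t y) y := by
  have hmeas := fun j => measurable_momentKernel j t
  have hint := fun j y => integrable_momentKernel_mul hφ hB j ht y
  set M : ℕ → ℝ → ℝ := fun j z => 2 ^ j * Real.exp (1 / (4 * t)) * momentMajorant j t (z - y)
  have hM : ∀ j, Integrable (M j) := fun j =>
    ((integrable_momentMajorant j ht).comp_sub_right y).const_mul _
  have hle : ∀ j z, ∀ x ∈ Metric.ball y 1, |momentKernel j t (z - x)| ≤ M j z := by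
    intro j z x hx
    have hxy : |x - y| ≤ 1 := (Metric.mem_ball.1 hx).le
    simpa only [sub_sub_sub_cancel_right] using abs_momentKernel_shift_le j ht hxy (z - y)
  have hderiv := (hasDerivAt_integral_of_dominated_loc_of_deriv_le (μ := volume)
    (F := fun y z => momentKernel k t (z - y) * φ z)
    (F' := fun y z => (-k * momentKernel (k - 1) t (z - y) +
      1 / (2 * t) * momentKernel (k + 1) t (z - y)) * φ z)
    (bound := fun z => (k * M (k - 1) z + 1 / (2 * t) * M (k + 1) z) * B)
    (Metric.ball_mem_nhds y one_pos)
    (.of_forall fun x => (hint k x).aestronglyMeasurable) (hint k y) (by fun_prop)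
    (ae_of_all _ fun z x hx => ?_)
    ((((hM (k - 1)).const_mul _).add ((hM (k + 1)).const_mul _)).mul_const B)
    (ae_of_all _ fun z x _ => ?_)).2
  · refine hderiv.congr_deriv ?_
    rw [heatMoment, heatMoment, ← integral_const_mul, ← integral_const_mul, ← integral_add
      ((hint _ _).const_mul _) ((hint _ _).const_mul _)]
    exact integral_congr_ae (ae_of_all _ fun z => by ring)
  · have hsum : |-k * momentKernel (k - 1) t (z - x) + 1 / (2 * t) * momentKernel (k + 1) t (z - x)|
        ≤ k * M (k - 1) z + 1 / (2 * t) * M (k + 1) z := by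
      refine (abs_add_le _ _).trans (add_le_add ?_ ?_)
      · rw [abs_mul, abs_neg, Nat.abs_cast]
        exact mul_le_mul_of_nonneg_left (hle _ _ _ hx) k.cast_nonneg
      · rw [abs_mul, abs_of_pos (by positivity : 0 < 1 / (2 * t))]
        exact mul_le_mul_of_nonneg_left (hle _ _ _ hx) (by positivity)
    rw [norm_mul, Real.norm_eq_abs, Real.norm_eq_abs]
    exact mul_le_mul hsum (hB z) (abs_nonneg _) ((abs_nonneg _).trans hsum)
  · exact (((hasDerivAt_momentKernel k t (z - x)).comp x
      ((hasDerivAt_id x).const_sub z)).mul_const _).congr_deriv (by ring)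

theorem hasDerivAt_heatMoment_time (hφ : Measurable φ) (hB : ∀ x, |φ x| ≤ B) (k : ℕ)
    (ht : 0 < t) (y : ℝ) :
    HasDerivAt (fun s => heatMoment φ k s y) (1 / (4 * t ^ 2) * heatMoment φ (k + 2) t y) t := by
  have hmeas := fun j => measurable_momentKernel j t
  have hnear : Ioo (t / 2) (2 * t) ∈ 𝓝 t := Ioo_mem_nhds (by linarith) (by linarith)
  have hderiv := (hasDerivAt_integral_of_dominated_loc_of_deriv_le (μ := volume)
    (F := fun s z => momentKernel k s (z - y) * φ z)
    (F' := fun s z => 1 / (4 * s ^ 2) * momentKernel (k + 2) s (z - y) * φ z)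
    (bound := fun z => 1 / t ^ 2 * momentMajorant (k + 2) t (z - y) * B) hnear
    (by filter_upwards [hnear] with s hs
        exact (integrable_momentKernel_mul hφ hB k (by linarith [hs.1]) y).aestronglyMeasurable)
    (integrable_momentKernel_mul hφ hB k ht y) (by fun_prop) (ae_of_all _ fun z s hs => ?_)
    ((((integrable_momentMajorant (k + 2) ht).comp_sub_right y).const_mul _).mul_const B)
    (ae_of_all _ fun z s hs => ?_)).2
  · refine hderiv.congr_deriv ?_
    simp only [heatMoment, mul_assoc, integral_const_mul]
  · have hs0 : 0 < s := by linarith [hs.1]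
    have hcoeff : 1 / (4 * s ^ 2) ≤ 1 / t ^ 2 :=
      one_div_le_one_div_of_le (by positivity) (by nlinarith [hs.1])
    rw [norm_mul, norm_mul, Real.norm_eq_abs (φ z), Real.norm_of_nonneg (by positivity),
      Real.norm_eq_abs]
    have hkernel := abs_momentKernel_le_of_le_two_mul (k + 2) hs0 hs.2.le (z - y)
    have hmaj := (abs_nonneg _).trans hkernel
    gcongr
    exact hB z
  · exact (hasDerivAt_momentKernel_time k (by linarith [hs.1] : 0 < s).ne' (z - y)).mul_const _

theorem lineFlow_eq_heatMoment (φ : ℝ → ℝ) (ht : 0 < t) (y : ℝ) :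
    lineFlow φ t y = (Real.sqrt (4 * Real.pi * t))⁻¹ * heatMoment φ 0 t y := by
  have h2 : (((2 * t).toNNReal : ℝ≥0) : ℝ) = 2 * t := Real.coe_toNNReal _ (by linarith)
  rw [lineFlow, heatMeasure, integral_gaussianReal_eq_integral_smul (toNNReal_two_mul_ne_zero ht),
    heatMoment, ← integral_const_mul, ← integral_add_right_eq_self (fun z => _ * (_ * φ z)) y]
  congr 1; ext z
  simp only [momentKernel, gaussianPDFReal, h2, smul_eq_mul, sub_zero, pow_zero,
    add_sub_cancel_right, add_comm y z, one_mul]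
  rw [show 2 * Real.pi * (2 * t) = 4 * Real.pi * t by ring,
    show -z ^ 2 / (2 * (2 * t)) = -(1 / (4 * t)) * z ^ 2 by field_simp; ring]
  ring

/-- The spatial derivative of the one-dimensional heat flow. -/
def lineFlowDeriv (φ : ℝ → ℝ) (t y : ℝ) : ℝ :=
  (Real.sqrt (4 * Real.pi * t))⁻¹ * (1 / (2 * t) * heatMoment φ 1 t y)

/-- The second spatial derivative of the one-dimensional heat flow. -/
def lineFlowDerivTwo (φ : ℝ → ℝ) (t y : ℝ) : ℝ :=
  (Real.sqrt (4 * Real.pi * t))⁻¹ *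
    (1 / (2 * t) * (-heatMoment φ 0 t y + 1 / (2 * t) * heatMoment φ 2 t y))

theorem hasDerivAt_lineFlow (hφ : Measurable φ) (hB : ∀ x, |φ x| ≤ B) (ht : 0 < t) (y : ℝ) :
    HasDerivAt (lineFlow φ t) (lineFlowDeriv φ t y) y := by
  rw [funext (lineFlow_eq_heatMoment φ ht)]
  have := (hasDerivAt_heatMoment hφ hB 0 ht y).const_mul (Real.sqrt (4 * Real.pi * t))⁻¹
  simpa [lineFlowDeriv] using this

theorem hasDerivAt_lineFlowDeriv (hφ : Measurable φ) (hB : ∀ x, |φ x| ≤ B) (ht : 0 < t) (y : ℝ) :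
    HasDerivAt (lineFlowDeriv φ t) (lineFlowDerivTwo φ t y) y := by
  have := ((hasDerivAt_heatMoment hφ hB 1 ht y).const_mul (1 / (2 * t))).const_mul
    (Real.sqrt (4 * Real.pi * t))⁻¹
  simpa [lineFlowDerivTwo, funext (lineFlowDeriv.eq_1 φ t)] using this

theorem hasDerivAt_lineFlow_time (hφ : Measurable φ) (hB : ∀ x, |φ x| ≤ B) (ht : 0 < t) (y : ℝ) :
    HasDerivAt (fun s => lineFlow φ s y) (lineFlowDerivTwo φ t y) t := by
  have hp : 0 < 4 * Real.pi * t := by positivity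
  have hnorm : HasDerivAt (fun s => (Real.sqrt (4 * Real.pi * s))⁻¹)
      (-(1 / (2 * t)) * (Real.sqrt (4 * Real.pi * t))⁻¹) t := by
    have hlin : HasDerivAt (fun s => 4 * Real.pi * s) (4 * Real.pi) t := by
      simpa using (hasDerivAt_id t).const_mul (4 * Real.pi)
    refine ((hlin.sqrt hp.ne').fun_inv (Real.sqrt_ne_zero'.2 hp)).congr_deriv ?_
    rw [Real.sq_sqrt hp.le]
    field_simp
  have hmul := hnorm.mul (hasDerivAt_heatMoment_time hφ hB 0 ht y)
  refine (hmul.congr_deriv ?_).congr_of_eventuallyEq ?_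
  · rw [lineFlowDerivTwo]; field_simp; ring
  · filter_upwards [lt_mem_nhds ht] with s hs using lineFlow_eq_heatMoment φ hs y

theorem abs_lineFlowDeriv_le {L : ℝ≥0} (hφ : LipschitzWith L φ) (hB : ∀ x, |φ x| ≤ B)
    (ht : 0 < t) (y : ℝ) : |lineFlowDeriv φ t y| ≤ L := by
  rw [← (hasDerivAt_lineFlow hφ.continuous.measurable hB ht y).deriv]
  exact norm_deriv_le_of_lipschitz (lipschitzWith_lineFlow hφ hB t)

end BoundedData

/-! ### A three-function maximum principle on the line -/

theorem second_deriv_nonpos_of_isLocalMax {h h' : ℝ → ℝ} {h'' x : ℝ}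
    (hh : ∀ s, HasDerivAt h (h' s) s) (hh' : HasDerivAt h' h'' x) (hmax : IsLocalMax h x) :
    h'' ≤ 0 := by
  by_contra! hpos
  have hderiv : deriv h = h' := funext fun s => (hh s).deriv
  have hderiv₂ : deriv (deriv h) x = h'' := by rw [hderiv]; exact hh'.deriv
  have hmin := isLocalMin_of_deriv_deriv_pos (hderiv₂ ▸ hpos) hmax.deriv_eq_zero
    (hh x).continuousAt
  have hconst : h =ᶠ[𝓝 x] fun _ => h x := by
    filter_upwards [hmax, hmin] with s hs1 hs2 using le_antisymm hs1 hs2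
  have hzero : deriv (deriv h) x = 0 := by simp [hconst.deriv.deriv_eq]
  linarith

/-- The function `C` damped by `e^{-κt}` and by a coercive penalty, so that it attains its maximum
over `t ≥ 0`. -/
def penalized (C : ℝ → ℝ → ℝ → ℝ) (κ δ ε t x y : ℝ) : ℝ :=
  Real.exp (-κ * t) * C t x y - δ ^ 2 * (x ^ 2 + y ^ 2) - ε * t

/-- The penalization of `C` has a positive maximum over `t ≥ 0`, attained at the point `(τ, a, b)`
with `τ > 0`. -/
structure IsPenalizedMax (C : ℝ → ℝ → ℝ → ℝ) (κ δ ε τ a b : ℝ) : Prop where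
  time_pos : 0 < τ
  val_pos : 0 < penalized C κ δ ε τ a b
  isMax : ∀ s x y, 0 ≤ s → penalized C κ δ ε s x y ≤ penalized C κ δ ε τ a b

theorem mul_norm_sub_one_le_penalty {δ ε : ℝ} {z : ℝ × ℝ × ℝ} (hz : 0 ≤ z.1) (hε : 0 ≤ ε) :
    min (δ ^ 2) ε * (‖z‖ - 1) ≤ δ ^ 2 * (z.2.1 ^ 2 + z.2.2 ^ 2) + ε * z.1 := by
  obtain ⟨t, x, y⟩ := z
  set c := min (δ ^ 2) ε
  have hc : 0 ≤ c := le_min (sq_nonneg δ) hε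
  have hquad : ∀ x : ℝ, c * (|x| - 1) ≤ δ ^ 2 * x ^ 2 := fun x =>
    (mul_le_mul_of_nonneg_left
      (by nlinarith [sq_abs x, abs_nonneg x, sq_nonneg (|x| - 1)]) hc).trans
      (mul_le_mul_of_nonneg_right (min_le_left _ _) (sq_nonneg x))
  have hlin : c * t ≤ ε * t := mul_le_mul_of_nonneg_right (min_le_right _ _) hz
  have hx : 0 ≤ δ ^ 2 * x ^ 2 := by positivity
  have hy : 0 ≤ δ ^ 2 * y ^ 2 := by positivity
  have ht : 0 ≤ ε * t := mul_nonneg hε hz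
  rw [Prod.norm_mk, Prod.norm_mk, Real.norm_of_nonneg hz, Real.norm_eq_abs, Real.norm_eq_abs]
  rcases max_choice t (max |x| |y|) with h | h <;> rw [h]
  · linarith
  · rcases max_choice |x| |y| with h' | h' <;> rw [h'] <;> linarith [hquad x, hquad y]

section Penalization

variable {C : ℝ → ℝ → ℝ → ℝ} {A κ δ ε : ℝ}

theorem exp_mul_le_of_le (hA : 0 ≤ A) (hκ : 0 ≤ κ) {t c : ℝ} (ht : 0 ≤ t) (hc : c ≤ A) :
    Real.exp (-κ * t) * c ≤ A :=
  (mul_le_mul_of_nonneg_left hc (Real.exp_pos _).le).trans <|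
    mul_le_of_le_one_left hA (Real.exp_le_one_iff.2 (by nlinarith))

theorem exists_forall_penalized_le
    (hC : ContinuousOn (fun z : ℝ × ℝ × ℝ => C z.1 z.2.1 z.2.2) {z | 0 ≤ z.1}) (hA : 0 ≤ A)
    (hCA : ∀ t x y, 0 ≤ t → C t x y ≤ A) (hκ : 0 ≤ κ) (hδ : 0 < δ) (hε : 0 < ε) (t x y : ℝ)
    (ht : 0 ≤ t) :
    ∃ τ a b, 0 ≤ τ ∧ penalized C κ δ ε t x y ≤ penalized C κ δ ε τ a b ∧
      ∀ s x y, 0 ≤ s → penalized C κ δ ε s x y ≤ penalized C κ δ ε τ a b := by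
  have hcont : ContinuousOn (fun z : ℝ × ℝ × ℝ => penalized C κ δ ε z.1 z.2.1 z.2.2)
      {z | 0 ≤ z.1} := by
    unfold penalized; fun_prop
  have hc : 0 < min (δ ^ 2) ε := lt_min (by positivity) hε
  have hfar : ∀ᶠ z : ℝ × ℝ × ℝ in cocompact _ ⊓ 𝓟 {z | 0 ≤ z.1},
      penalized C κ δ ε z.1 z.2.1 z.2.2 ≤ penalized C κ δ ε t x y := by
    rw [eventually_inf_principal]
    filter_upwards [(tendsto_norm_cocompact_atTop (E := ℝ × ℝ × ℝ)).eventually_ge_atTop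
      ((A - penalized C κ δ ε t x y) / min (δ ^ 2) ε + 1)] with z hnorm hz
    have hpenalty := mul_norm_sub_one_le_penalty (δ := δ) hz hε.le
    rw [← le_sub_iff_add_le, div_le_iff₀' hc] at hnorm
    have hdamped := exp_mul_le_of_le hA hκ hz (hCA z.1 z.2.1 z.2.2 hz)
    simp only [penalized] at hnorm ⊢
    linarith
  obtain ⟨⟨τ, a, b⟩, hτ, hmax⟩ := hcont.exists_isMaxOn'
    (isClosed_le continuous_const continuous_fst) (x₀ := (t, x, y)) ht hfar
  exact ⟨τ, a, b, hτ, hmax (a := (t, x, y)) ht, fun s x y hs => hmax (a := (s, x, y)) hs⟩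

theorem exists_isPenalizedMax
    (hC : ContinuousOn (fun z : ℝ × ℝ × ℝ => C z.1 z.2.1 z.2.2) {z | 0 ≤ z.1}) (hA : 0 ≤ A)
    (hCA : ∀ t x y, 0 ≤ t → C t x y ≤ A) (hκ : 0 ≤ κ) (hstart : ∀ x y, C 0 x y ≤ 0)
    {ω : ℝ → ℝ} (hω : Tendsto ω (𝓝 0) (𝓝 0)) {t x y : ℝ} (ht : 0 ≤ t) (hpos : 0 < C t x y) :
    ∃ δ ε τ a b, 0 < δ ∧ ω δ < ε ∧ IsPenalizedMax C κ δ ε τ a b := by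
  set D := Real.exp (-κ * t) * C t x y with hD
  have hDpos : 0 < D := by positivity
  set ε := D / (4 * (1 + t)) with hε
  have hεpos : 0 < ε := by positivity
  have hεt : ε * t ≤ D / 4 := by
    rw [hε, div_mul_eq_mul_div, div_le_div_iff₀ (by positivity) (by norm_num)]
    nlinarith
  have hsmall : ∀ᶠ δ : ℝ in 𝓝 0, δ ^ 2 * (x ^ 2 + y ^ 2) < D / 4 :=
    (Continuous.tendsto' (by fun_prop) 0 0 (by simp)).eventually_lt_const (by positivity)
  obtain ⟨δ, ⟨hδsmall, hδω⟩, hδ⟩ :=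
    (((hsmall.and (hω.eventually_lt_const hεpos)).filter_mono nhdsWithin_le_nhds).and
      (self_mem_nhdsWithin : Ioi (0 : ℝ) ∈ 𝓝[>] 0)).exists
  obtain ⟨τ, a, b, hτ, hle, hmax⟩ := exists_forall_penalized_le hC hA hCA hκ hδ hεpos t x y ht
  have hval : 0 < penalized C κ δ ε τ a b := by
    refine lt_of_lt_of_le ?_ hle
    rw [penalized, ← hD]
    linarith
  refine ⟨δ, ε, τ, a, b, hδ, hδω, hτ.lt_of_ne fun h => ?_, hval, hmax⟩
  have hpenalty : 0 ≤ δ ^ 2 * (a ^ 2 + b ^ 2) := by positivity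
  have hzero := hstart a b
  simp only [penalized, ← h, mul_zero, Real.exp_zero, one_mul] at hval
  linarith

variable {τ a b : ℝ}

theorem IsPenalizedMax.damped_pos (h : IsPenalizedMax C κ δ ε τ a b) (hε : 0 ≤ ε) :
    0 < Real.exp (-κ * τ) * C τ a b := by
  have hval := h.val_pos
  have htime := mul_nonneg hε h.time_pos.le
  have hpenalty : 0 ≤ δ ^ 2 * (a ^ 2 + b ^ 2) := by positivity
  rw [penalized] at hval
  linarith

theorem IsPenalizedMax.abs_sq_mul_le (h : IsPenalizedMax C κ δ ε τ a b) (hA : 0 ≤ A)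
    (hCA : C τ a b ≤ A) (hκ : 0 ≤ κ) (hδ : 0 ≤ δ) (hε : 0 ≤ ε) :
    |δ ^ 2 * a| ≤ δ * Real.sqrt A ∧ |δ ^ 2 * b| ≤ δ * Real.sqrt A := by
  have hdamped := exp_mul_le_of_le hA hκ h.time_pos.le hCA
  have hval := h.val_pos
  have htime := mul_nonneg hε h.time_pos.le
  have ha : 0 ≤ (δ * a) ^ 2 := sq_nonneg _
  have hb : 0 ≤ (δ * b) ^ 2 := sq_nonneg _
  have hscale : ∀ c : ℝ, (δ * c) ^ 2 ≤ A → |δ ^ 2 * c| ≤ δ * Real.sqrt A := fun c hc => by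
    rw [sq, mul_assoc, abs_mul, abs_of_nonneg hδ]
    exact mul_le_mul_of_nonneg_left (Real.abs_le_sqrt hc) hδ
  rw [penalized, mul_add, ← mul_pow, ← mul_pow] at hval
  exact ⟨hscale a (by linarith), hscale b (by linarith)⟩

theorem hasDerivAt_penalized_line (p q : ℝ) {d x : ℝ}
    (hd : HasDerivAt (fun x => C τ (a + p * x) (b + q * x)) d x) :
    HasDerivAt (fun x => penalized C κ δ ε τ (a + p * x) (b + q * x))
      (Real.exp (-κ * τ) * d - 2 * δ ^ 2 * (p * (a + p * x) + q * (b + q * x))) x := by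
  have hline : ∀ c r : ℝ, HasDerivAt (fun x => c + r * x) r x := fun c r => by
    simpa using ((hasDerivAt_id x).const_mul r).const_add c
  refine (((hd.const_mul (Real.exp (-κ * τ))).sub ((((hline a p).fun_pow 2).add
    ((hline b q).fun_pow 2)).const_mul (δ ^ 2))).sub_const (ε * τ)).congr_deriv ?_
  push_cast
  ring

theorem IsPenalizedMax.isLocalMax_line (h : IsPenalizedMax C κ δ ε τ a b) (p q : ℝ) :
    IsLocalMax (fun x => penalized C κ δ ε τ (a + p * x) (b + q * x)) 0 :=
  .of_forall fun x => by simpa using h.isMax τ (a + p * x) (b + q * x) h.time_pos.le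

theorem IsPenalizedMax.first_order (h : IsPenalizedMax C κ δ ε τ a b) (p q : ℝ) {d : ℝ}
    (hd : HasDerivAt (fun x => C τ (a + p * x) (b + q * x)) d 0) :
    Real.exp (-κ * τ) * d = 2 * δ ^ 2 * (p * a + q * b) := by
  have := (h.isLocalMax_line p q).hasDerivAt_eq_zero (hasDerivAt_penalized_line p q hd)
  simp only [mul_zero, add_zero] at this
  linarith

theorem IsPenalizedMax.second_order (h : IsPenalizedMax C κ δ ε τ a b) (p q : ℝ) {d : ℝ → ℝ}
    {d' : ℝ} (hd : ∀ x, HasDerivAt (fun x => C τ (a + p * x) (b + q * x)) (d x) x)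
    (hd' : HasDerivAt d d' 0) :
    Real.exp (-κ * τ) * d' ≤ 2 * δ ^ 2 * (p ^ 2 + q ^ 2) := by
  have hline : ∀ c r : ℝ, HasDerivAt (fun x => r * (c + r * x)) (r * r) 0 := fun c r => by
    simpa using (((hasDerivAt_id (0 : ℝ)).const_mul r).const_add c).const_mul r
  have := second_deriv_nonpos_of_isLocalMax (fun x => hasDerivAt_penalized_line p q (hd x))
    ((hd'.const_mul _).sub (((hline a p).add (hline b q)).const_mul (2 * δ ^ 2)))
    (h.isLocalMax_line p q)
  linarith

theorem IsPenalizedMax.time_order (h : IsPenalizedMax C κ δ ε τ a b) {d : ℝ}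
    (hd : HasDerivAt (fun s => C s a b) d τ) :
    Real.exp (-κ * τ) * (d - κ * C τ a b) = ε := by
  have hmax : IsLocalMax (fun s => penalized C κ δ ε s a b) τ := by
    filter_upwards [lt_mem_nhds h.time_pos] with s hs using h.isMax s a b hs.le
  have hexp : HasDerivAt (fun s => Real.exp (-κ * s)) (Real.exp (-κ * τ) * -κ) τ := by
    simpa using ((hasDerivAt_id τ).const_mul (-κ)).exp
  have := hmax.hasDerivAt_eq_zero (((hexp.mul hd).sub_const (δ ^ 2 * (a ^ 2 + b ^ 2))).sub
    ((hasDerivAt_id τ).const_mul ε))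
  linarith

end Penalization

/-- A bounded solution `u` of `u_t = u_yy + G u_y²` on the half-plane `t > 0`, continuous up to
`t = 0`, with bounded slope `u_y` and bounded coefficient `G`; a single constant `K` bounds all
three. -/
structure GradientSolution (K : ℝ) where
  /-- The solution `u`. -/
  val : ℝ → ℝ → ℝ
  /-- The first spatial derivative `u_y`. -/
  slope : ℝ → ℝ → ℝ
  /-- The second spatial derivative `u_yy`. -/
  curv : ℝ → ℝ → ℝ
  /-- The coefficient `G`. -/
  coeff : ℝ → ℝ → ℝ
  continuousOn_val : ContinuousOn (fun z : ℝ × ℝ => val z.1 z.2) {z | 0 ≤ z.1}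
  abs_val_le : ∀ t y, 0 ≤ t → |val t y| ≤ K
  hasDerivAt_val : ∀ t y, 0 < t → HasDerivAt (val t) (slope t y) y
  hasDerivAt_slope : ∀ t y, 0 < t → HasDerivAt (slope t) (curv t y) y
  hasDerivAt_time : ∀ t y, 0 < t →
    HasDerivAt (fun s => val s y) (curv t y + coeff t y * slope t y ^ 2) t
  abs_slope_le : ∀ t y, 0 < t → |slope t y| ≤ K
  abs_coeff_le : ∀ t y, 0 < t → |coeff t y| ≤ K

/-- The amount by which `w` exceeds the `(l, m)`-combination of `u` and `v`; the three-function
inequality is its nonpositivity. -/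
def defect {K : ℝ} (w u v : GradientSolution K) (l m t x y : ℝ) : ℝ :=
  w.val t (l * x + m * y) - l * u.val t x - m * v.val t y

section Defect

variable {K : ℝ} (w u v : GradientSolution K)

theorem continuousOn_defect (l m : ℝ) :
    ContinuousOn (fun z : ℝ × ℝ × ℝ => defect w u v l m z.1 z.2.1 z.2.2) {z | 0 ≤ z.1} := by
  have hw := w.continuousOn_val.comp (f := fun z : ℝ × ℝ × ℝ => (z.1, l * z.2.1 + m * z.2.2))
    (s := {z | 0 ≤ z.1}) (by fun_prop) fun z hz => hz
  have hu := u.continuousOn_val.comp (f := fun z : ℝ × ℝ × ℝ => (z.1, z.2.1))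
    (s := {z | 0 ≤ z.1}) (by fun_prop) fun z hz => hz
  have hv := v.continuousOn_val.comp (f := fun z : ℝ × ℝ × ℝ => (z.1, z.2.2))
    (s := {z | 0 ≤ z.1}) (by fun_prop) fun z hz => hz
  exact (hw.sub (hu.const_mul l)).sub (hv.const_mul m)

theorem defect_le {l m : ℝ} (hl : 0 ≤ l) (hm : 0 ≤ m) (hlm : l + m = 1) (t x y : ℝ)
    (ht : 0 ≤ t) : defect w u v l m t x y ≤ 2 * K := by
  have hw := (abs_le.1 (w.abs_val_le t (l * x + m * y) ht)).2
  have hu := mul_le_mul_of_nonneg_left (abs_le.1 (u.abs_val_le t x ht)).1 hl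
  have hv := mul_le_mul_of_nonneg_left (abs_le.1 (v.abs_val_le t y ht)).1 hm
  have hsum : l * K + m * K = K := by rw [← add_mul, hlm, one_mul]
  rw [defect]
  linarith

theorem hasDerivAt_defect_line (l m a b p q : ℝ) {t : ℝ} (ht : 0 < t) (h : ℝ) :
    HasDerivAt (fun h => defect w u v l m t (a + p * h) (b + q * h))
      (w.slope t (l * (a + p * h) + m * (b + q * h)) * (l * p + m * q) -
        l * (u.slope t (a + p * h) * p) - m * (v.slope t (b + q * h) * q)) h := by
  have hline : ∀ c r : ℝ, HasDerivAt (fun h => c + r * h) r h := fun c r => by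
    simpa using ((hasDerivAt_id h).const_mul r).const_add c
  exact ((HasDerivAt.comp h (w.hasDerivAt_val t _ ht)
    (((hline a p).const_mul l).add ((hline b q).const_mul m))).sub
    (((u.hasDerivAt_val t _ ht).comp h (hline a p)).const_mul l)).sub
    (((v.hasDerivAt_val t _ ht).comp h (hline b q)).const_mul m)

theorem hasDerivAt_defect_line_deriv (l m a b p q : ℝ) {t : ℝ} (ht : 0 < t) :
    HasDerivAt (fun h => w.slope t (l * (a + p * h) + m * (b + q * h)) * (l * p + m * q) -
        l * (u.slope t (a + p * h) * p) - m * (v.slope t (b + q * h) * q))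
      (w.curv t (l * a + m * b) * (l * p + m * q) ^ 2 - l * (u.curv t a * p ^ 2) -
        m * (v.curv t b * q ^ 2)) 0 := by
  have hline : ∀ c r : ℝ, HasDerivAt (fun h => c + r * h) r 0 := fun c r => by
    simpa using ((hasDerivAt_id (0 : ℝ)).const_mul r).const_add c
  refine (((HasDerivAt.comp 0 (w.hasDerivAt_slope t _ ht)
    (((hline a p).const_mul l).add ((hline b q).const_mul m))).mul_const _ |>.sub
    ((((u.hasDerivAt_slope t _ ht).comp 0 (hline a p)).mul_const _).const_mul l)).sub
    ((((v.hasDerivAt_slope t _ ht).comp 0 (hline b q)).mul_const _).const_mul m)).congr_deriv ?_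
  simp only [Pi.add_apply, mul_zero, add_zero]
  ring

theorem hasDerivAt_defect_time (l m x y : ℝ) {t : ℝ} (ht : 0 < t) :
    HasDerivAt (fun s => defect w u v l m s x y)
      (w.curv t (l * x + m * y) + w.coeff t (l * x + m * y) * w.slope t (l * x + m * y) ^ 2 -
        l * (u.curv t x + u.coeff t x * u.slope t x ^ 2) -
        m * (v.curv t y + v.coeff t y * v.slope t y ^ 2)) t :=
  ((w.hasDerivAt_time t _ ht).sub ((u.hasDerivAt_time t x ht).const_mul l)).sub
    ((v.hasDerivAt_time t y ht).const_mul m)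

end Defect

theorem mul_coeff_mul_sq_sub_sq_le {K s l p p' G x : ℝ} (hp : |p| ≤ K) (hp' : |p'| ≤ K)
    (hG : |G| ≤ K) (hx : s * (l * (p - p')) = 2 * x) :
    s * (l * (G * (p ^ 2 - p' ^ 2))) ≤ 4 * K ^ 2 * |x| := by
  have hK : 0 ≤ K := (abs_nonneg _).trans hp
  have hsum : |p + p'| ≤ 2 * K := (abs_add_le _ _).trans (by linarith)
  calc s * (l * (G * (p ^ 2 - p' ^ 2))) = s * (l * (p - p')) * (G * (p + p')) := by ring
    _ = 2 * x * (G * (p + p')) := by rw [hx]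
    _ ≤ |2 * x * (G * (p + p'))| := le_abs_self _
    _ = 2 * |x| * (|G| * |p + p'|) := by rw [abs_mul, abs_mul, abs_mul, abs_two]
    _ ≤ 2 * |x| * (K * (2 * K)) := by gcongr
    _ = 4 * K ^ 2 * |x| := by ring

/-- At the maximum the slopes of the three solutions differ by `O(δ)` only, so that the penalty `ε`
must be that small as well. -/
theorem IsPenalizedMax.eps_le {K l m Λ δ ε τ a b : ℝ} {w u v : GradientSolution K}
    (h : IsPenalizedMax (defect w u v l m) (Λ * K ^ 2) δ ε τ a b) (hl : 0 ≤ l) (hm : 0 ≤ m)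
    (hlm : l + m = 1) (hΛ : 0 ≤ Λ) (hδ : 0 ≤ δ) (hε : 0 ≤ ε)
    (hcoeff : 0 ≤ defect w u v l m τ a b →
      w.coeff τ (l * a + m * b) - l * u.coeff τ a - m * v.coeff τ b ≤
        Λ * defect w u v l m τ a b) :
    ε ≤ 4 * δ ^ 2 + 8 * K ^ 2 * (δ * Real.sqrt (2 * K)) := by
  have hτ := h.time_pos
  have hK : 0 ≤ K := (abs_nonneg _).trans (w.abs_val_le 0 0 le_rfl)
  set c := l * a + m * b
  set s := Real.exp (-(Λ * K ^ 2) * τ)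
  have hs : 0 < s := Real.exp_pos _
  have hslope : |w.slope τ c| ≤ K := w.abs_slope_le τ c hτ
  have hdefect : 0 < defect w u v l m τ a b := pos_of_mul_pos_right (h.damped_pos hε) hs.le
  obtain ⟨ha, hb⟩ := h.abs_sq_mul_le (by positivity) (defect_le w u v hl hm hlm τ a b hτ.le)
    (by positivity) hδ hε
  have hslope_u : s * (l * (w.slope τ c - u.slope τ a)) = 2 * (δ ^ 2 * a) := by
    have := h.first_order 1 0 (hasDerivAt_defect_line w u v l m a b 1 0 hτ 0)
    simp only [mul_zero, add_zero, mul_one, sub_zero, one_mul, zero_mul] at this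
    linear_combination this
  have hslope_v : s * (m * (w.slope τ c - v.slope τ b)) = 2 * (δ ^ 2 * b) := by
    have := h.first_order 0 1 (hasDerivAt_defect_line w u v l m a b 0 1 hτ 0)
    simp only [mul_zero, add_zero, zero_add, mul_one, sub_zero, one_mul, zero_mul] at this
    linear_combination this
  have hcurv : s * (w.curv τ c - l * u.curv τ a - m * v.curv τ b) ≤ 4 * δ ^ 2 := by
    have := h.second_order 1 1 (hasDerivAt_defect_line w u v l m a b 1 1 hτ)
      (hasDerivAt_defect_line_deriv w u v l m a b 1 1 hτ)
    simp only [mul_one, hlm, one_pow] at this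
    linarith
  have htime := h.time_order (hasDerivAt_defect_time w u v l m a b hτ)
  have herror_u := mul_coeff_mul_sq_sub_sq_le hslope (u.abs_slope_le τ a hτ)
    (u.abs_coeff_le τ a hτ) hslope_u
  have herror_v := mul_coeff_mul_sq_sub_sq_le hslope (v.abs_slope_le τ b hτ)
    (v.abs_coeff_le τ b hτ) hslope_v
  have hgradient : w.slope τ c ^ 2 * (w.coeff τ c - l * u.coeff τ a - m * v.coeff τ b) ≤
      Λ * K ^ 2 * defect w u v l m τ a b := by
    calc _ ≤ w.slope τ c ^ 2 * (Λ * defect w u v l m τ a b) :=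
          mul_le_mul_of_nonneg_left (hcoeff hdefect.le) (sq_nonneg _)
      _ ≤ K ^ 2 * (Λ * defect w u v l m τ a b) :=
          mul_le_mul_of_nonneg_right (sq_le_sq' (abs_le.1 hslope).1 (abs_le.1 hslope).2)
            (by positivity)
      _ = _ := by ring
  have hgradient_damped := mul_le_mul_of_nonneg_left hgradient hs.le
  have ha' := mul_le_mul_of_nonneg_left ha (by positivity : 0 ≤ 4 * K ^ 2)
  have hb' := mul_le_mul_of_nonneg_left hb (by positivity : 0 ≤ 4 * K ^ 2)
  linarith

theorem three_function_maximum_principle {K l m Λ : ℝ} (w u v : GradientSolution K) (hl : 0 ≤ l)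
    (hm : 0 ≤ m) (hlm : l + m = 1) (hΛ : 0 ≤ Λ) (hstart : ∀ x y, defect w u v l m 0 x y ≤ 0)
    (hcoeff : ∀ t x y, 0 < t → 0 ≤ defect w u v l m t x y →
      w.coeff t (l * x + m * y) - l * u.coeff t x - m * v.coeff t y ≤
        Λ * defect w u v l m t x y)
    {t : ℝ} (ht : 0 ≤ t) (x y : ℝ) : defect w u v l m t x y ≤ 0 := by
  by_contra! hpos
  have hK : 0 ≤ K := (abs_nonneg _).trans (w.abs_val_le 0 0 le_rfl)
  have hω : Tendsto (fun δ => 4 * δ ^ 2 + 8 * K ^ 2 * (δ * Real.sqrt (2 * K))) (𝓝 0) (𝓝 0) :=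
    Continuous.tendsto' (by fun_prop) 0 0 (by simp)
  obtain ⟨δ, ε, τ, a, b, hδ, hωε, hmax⟩ := exists_isPenalizedMax (κ := Λ * K ^ 2)
    (continuousOn_defect w u v l m) (by positivity) (defect_le w u v hl hm hlm) (by positivity)
    hstart hω ht hpos
  have hε : 0 ≤ ε := le_trans (by positivity) hωε.le
  exact hωε.not_ge (hmax.eps_le hl hm hlm hΛ hδ.le hε (hcoeff τ a b hmax.time_pos))

/-! ### The three-function inequality for Gaussian averages -/

/-- The coefficient `-F''/F'²` of the equation `v_t = v_yy + (-F''/F'²)(u) v_y²` satisfied by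
`v = F(u)` for a solution `u` of the heat equation. It equals `g_F ∘ F`. -/
def gradCoeff (F : ℝ → ℝ) (r : ℝ) : ℝ := -deriv (deriv F) r / deriv F r ^ 2

theorem hasDerivAt_deriv_of_contDiff_two {F : ℝ → ℝ} (hF : ContDiff ℝ 2 F) (r : ℝ) :
    HasDerivAt (deriv F) (deriv (deriv F) r) r :=
  ((hF.iterate_deriv' 1 1).differentiable one_ne_zero r).hasDerivAt

theorem continuous_deriv_deriv_of_contDiff_two {F : ℝ → ℝ} (hF : ContDiff ℝ 2 F) :
    Continuous (deriv (deriv F)) := (hF.iterate_deriv' 0 2).continuous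

theorem continuous_gradCoeff {F : ℝ → ℝ} (hF : ContDiff ℝ 2 F) (hF' : ∀ r, 0 < deriv F r) :
    Continuous (gradCoeff F) :=
  (continuous_deriv_deriv_of_contDiff_two hF).neg.div ((hF.continuous_deriv one_le_two).pow 2)
    fun r => (pow_pos (hF' r) 2).ne'

theorem exists_gradientSolution {F : ℝ → ℝ} (hF : ContDiff ℝ 2 F) (hF' : ∀ r, 0 < deriv F r)
    (α β : ℝ) (L : ℝ≥0) : ∃ K : ℝ, ∀ φ : ℝ → ℝ, LipschitzWith L φ → (∀ x, φ x ∈ Icc α β) →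
      ∃ v : GradientSolution K, (v.val = fun t y => F (lineFlow φ t y)) ∧
        v.coeff = fun t y => gradCoeff F (lineFlow φ t y) := by
  have hdF := fun r => (hF.differentiable two_ne_zero r).hasDerivAt
  have hddF := hasDerivAt_deriv_of_contDiff_two hF
  obtain ⟨K₀, hK₀⟩ := isCompact_Icc.exists_bound_of_continuousOn
    (hF.continuous.continuousOn (s := Icc α β))
  obtain ⟨K₁, hK₁⟩ := isCompact_Icc.exists_bound_of_continuousOn
    ((hF.continuous_deriv one_le_two).continuousOn (s := Icc α β))
  obtain ⟨K₂, hK₂⟩ := isCompact_Icc.exists_bound_of_continuousOn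
    ((continuous_gradCoeff hF hF').continuousOn (s := Icc α β))
  refine ⟨max K₀ (max (K₁ * L) K₂), fun φ hφ hαβ => ?_⟩
  have hmeas := hφ.continuous.measurable
  have hbdd := fun x => abs_le_max_abs_abs (hαβ x).1 (hαβ x).2
  have hu := lineFlow_mem_Icc hmeas hαβ
  have hslope : ∀ t y, 0 < t → HasDerivAt (fun y => F (lineFlow φ t y))
      (deriv F (lineFlow φ t y) * lineFlowDeriv φ t y) y := fun t y ht =>
    (hdF _).comp y (hasDerivAt_lineFlow hmeas hbdd ht y)
  have hcurv : ∀ t y, 0 < t → HasDerivAt (fun y => deriv F (lineFlow φ t y) * lineFlowDeriv φ t y)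
      (deriv (deriv F) (lineFlow φ t y) * lineFlowDeriv φ t y ^ 2 +
        deriv F (lineFlow φ t y) * lineFlowDerivTwo φ t y) y := fun t y ht => by
    refine (((hddF _).comp y (hasDerivAt_lineFlow hmeas hbdd ht y)).mul
      (hasDerivAt_lineFlowDeriv hmeas hbdd ht y)).congr_deriv ?_
    simp only [Function.comp]
    ring
  refine ⟨⟨_, _, _, fun t y => gradCoeff F (lineFlow φ t y),
    hF.continuous.comp_continuousOn (continuousOn_lineFlow hφ.continuous hbdd),
    fun t y _ => le_max_of_le_left (hK₀ _ (hu t y)), hslope, hcurv, fun t y ht => ?_,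
    fun t y ht => ?_, fun t y _ => le_max_of_le_right (le_max_of_le_right (hK₂ _ (hu t y)))⟩,
    rfl, rfl⟩
  · refine ((hdF _).comp t (hasDerivAt_lineFlow_time hmeas hbdd ht y)).congr_deriv ?_
    have := (hF' (lineFlow φ t y)).ne'
    rw [gradCoeff]
    field_simp
    ring
  · rw [abs_mul]
    exact le_max_of_le_right <| le_max_of_le_left <| mul_le_mul (hK₁ _ (hu t y))
      (abs_lineFlowDeriv_le hφ hbdd ht y) (abs_nonneg _) ((abs_nonneg _).trans (hK₁ _ (hu t y)))

/-- Wherever the convexity defect of `F` on `[α, β]` is nonnegative, `Λ` times it bounds the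
defect of `gradCoeff F`; this is what the maximum principle requires of `F`. -/
def CoeffBound (F : ℝ → ℝ) (α β l m Λ : ℝ) : Prop :=
  ∀ r ∈ Icc α β, ∀ r₀ ∈ Icc α β, ∀ r₁ ∈ Icc α β, l * F r₀ + m * F r₁ ≤ F r →
    gradCoeff F r - l * gradCoeff F r₀ - m * gradCoeff F r₁ ≤ Λ * (F r - l * F r₀ - m * F r₁)

theorem lineFlow_three_function {F : ℝ → ℝ} (hF : ContDiff ℝ 2 F) (hF' : ∀ r, 0 < deriv F r)
    {α β l m Λ : ℝ} (hl : 0 ≤ l) (hm : 0 ≤ m) (hlm : l + m = 1) (hΛ : 0 ≤ Λ)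
    (hcb : CoeffBound F α β l m Λ) {L : ℝ≥0} {φ φ₀ φ₁ : ℝ → ℝ} (hφ : LipschitzWith L φ)
    (hφ₀ : LipschitzWith L φ₀) (hφ₁ : LipschitzWith L φ₁) (hI : ∀ x, φ x ∈ Icc α β)
    (hI₀ : ∀ x, φ₀ x ∈ Icc α β) (hI₁ : ∀ x, φ₁ x ∈ Icc α β)
    (h : ∀ x y, F (φ (l * x + m * y)) ≤ l * F (φ₀ x) + m * F (φ₁ y)) {t : ℝ} (ht : 0 ≤ t)
    (x y : ℝ) :
    F (lineFlow φ t (l * x + m * y)) ≤ l * F (lineFlow φ₀ t x) + m * F (lineFlow φ₁ t y) := by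
  obtain ⟨K, hK⟩ := exists_gradientSolution hF hF' α β L
  obtain ⟨w, hw, hwcoeff⟩ := hK φ hφ hI
  obtain ⟨u, hu, hucoeff⟩ := hK φ₀ hφ₀ hI₀
  obtain ⟨v, hv, hvcoeff⟩ := hK φ₁ hφ₁ hI₁
  have hmeas := hφ.continuous.measurable
  have hmeas₀ := hφ₀.continuous.measurable
  have hmeas₁ := hφ₁.continuous.measurable
  have hdefect : ∀ t x y, defect w u v l m t x y = F (lineFlow φ t (l * x + m * y)) -
      l * F (lineFlow φ₀ t x) - m * F (lineFlow φ₁ t y) := fun t x y => by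
    rw [defect, hw, hu, hv]
  have hle := three_function_maximum_principle w u v hl hm hlm hΛ
    (fun x y => by
      rw [hdefect, lineFlow_zero hmeas, lineFlow_zero hmeas₀, lineFlow_zero hmeas₁]
      linarith [h x y])
    (fun t x y _ hpos => by
      rw [hdefect] at hpos ⊢
      rw [hwcoeff, hucoeff, hvcoeff]
      exact hcb _ (lineFlow_mem_Icc hmeas hI _ _) _ (lineFlow_mem_Icc hmeas₀ hI₀ _ _) _
        (lineFlow_mem_Icc hmeas₁ hI₁ _ _) (by linarith)) ht x y
  rw [hdefect] at hle
  linarith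

theorem integrable_heatMeasurePi_of_lipschitz {n : ℕ} {φ : (Fin n → ℝ) → ℝ} {L : ℝ≥0}
    (hφ : LipschitzWith L φ) {α β : ℝ} (hI : ∀ x, φ x ∈ Icc α β) (t : ℝ) :
    Integrable φ (heatMeasurePi n t) :=
  Integrable.of_bound hφ.continuous.aestronglyMeasurable (max |α| |β|)
    (ae_of_all _ fun x => abs_le_max_abs_abs (hI x).1 (hI x).2)

theorem integral_heatMeasurePi_zero (φ : (Fin 0 → ℝ) → ℝ) (t : ℝ) :
    ∫ x, φ x ∂(heatMeasurePi 0 t) = φ 0 := by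
  rw [show φ = fun _ => φ 0 from funext fun x => congrArg φ (Subsingleton.elim _ _)]
  simp

theorem integral_heatMeasurePi_succ {n : ℕ} {φ : (Fin (n + 1) → ℝ) → ℝ} {t : ℝ}
    (hφ : Integrable φ (heatMeasurePi (n + 1) t)) :
    ∫ x, φ x ∂(heatMeasurePi (n + 1) t) =
      ∫ x, lineFlow (fun s => φ (Fin.cons s x)) t 0 ∂(heatMeasurePi n t) := by
  have hp := (measurePreserving_piFinSuccAbove (fun _ : Fin (n + 1) => heatMeasure t) 0).symm
  have hi := (hp.integrable_comp_emb (MeasurableEquiv.measurableEmbedding _)).2 hφ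
  have hcons : ∀ z : ℝ × (Fin n → ℝ), (MeasurableEquiv.piFinSuccAbove (fun _ => ℝ) 0).symm z =
      (Fin.cons z.1 z.2 : Fin (n + 1) → ℝ) := by
    intro z
    simp [MeasurableEquiv.piFinSuccAbove_symm_apply, Fin.insertNthEquiv]
  rw [heatMeasurePi, ← hp.integral_comp']
  refine (integral_prod_symm _ hi).trans ?_
  simp only [Function.comp, hcons, lineFlow, zero_add]
  rfl

theorem lipschitzWith_cons_left {n : ℕ} (x : Fin n → ℝ) :
    LipschitzWith 1 fun s : ℝ => (Fin.cons s x : Fin (n + 1) → ℝ) :=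
  LipschitzWith.of_dist_le_mul fun s s' => by
    rw [NNReal.coe_one, one_mul]
    refine (dist_pi_le_iff dist_nonneg).2 fun i => ?_
    cases i using Fin.cases <;> simp

theorem lipschitzWith_cons_right {n : ℕ} (s : ℝ) :
    LipschitzWith 1 fun x : Fin n → ℝ => (Fin.cons s x : Fin (n + 1) → ℝ) :=
  LipschitzWith.of_dist_le_mul fun x x' => by
    rw [NNReal.coe_one, one_mul]
    refine (dist_pi_le_iff dist_nonneg).2 fun i => ?_
    cases i using Fin.cases with
    | zero => simp
    | succ i => simpa using dist_le_pi_dist x x' i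

theorem lipschitzWith_comp_cons {n : ℕ} {φ : (Fin (n + 1) → ℝ) → ℝ} {L : ℝ≥0}
    (hφ : LipschitzWith L φ) (x : Fin n → ℝ) : LipschitzWith L fun s => φ (Fin.cons s x) := by
  simpa [Function.comp_def] using hφ.comp (lipschitzWith_cons_left x)

theorem lipschitzWith_lineFlow_cons {n : ℕ} {φ : (Fin (n + 1) → ℝ) → ℝ} {L : ℝ≥0}
    (hφ : LipschitzWith L φ) {α β : ℝ} (hI : ∀ x, φ x ∈ Icc α β) (t : ℝ) :
    LipschitzWith L fun x : Fin n → ℝ => lineFlow (fun s => φ (Fin.cons s x)) t 0 :=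
  lipschitzWith_integral
    (fun x => integrable_comp_add_of_bdd (lipschitzWith_comp_cons hφ x).continuous.measurable
      (fun _ => abs_le_max_abs_abs (hI _).1 (hI _).2) _ 0)
    fun z => by simpa [Function.comp_def] using hφ.comp (lipschitzWith_cons_right (n := n) (0 + z))

theorem cons_smul_add_smul {n : ℕ} (l m a b : ℝ) (x y : Fin n → ℝ) :
    (Fin.cons (l * a + m * b) (l • x + m • y) : Fin (n + 1) → ℝ) =
      l • (Fin.cons a x : Fin (n + 1) → ℝ) + m • (Fin.cons b y : Fin (n + 1) → ℝ) := by
  funext i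
  cases i using Fin.cases <;> simp

theorem gaussian_three_function {F : ℝ → ℝ} (hF : ContDiff ℝ 2 F) (hF' : ∀ r, 0 < deriv F r)
    {α β l m Λ : ℝ} (hl : 0 ≤ l) (hm : 0 ≤ m) (hlm : l + m = 1) (hΛ : 0 ≤ Λ)
    (hcb : CoeffBound F α β l m Λ) {L : ℝ≥0} {t : ℝ} (ht : 0 ≤ t) {n : ℕ}
    {φ φ₀ φ₁ : (Fin n → ℝ) → ℝ} (hφ : LipschitzWith L φ) (hφ₀ : LipschitzWith L φ₀)
    (hφ₁ : LipschitzWith L φ₁) (hI : ∀ x, φ x ∈ Icc α β) (hI₀ : ∀ x, φ₀ x ∈ Icc α β)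
    (hI₁ : ∀ x, φ₁ x ∈ Icc α β)
    (h : ∀ x y, F (φ (l • x + m • y)) ≤ l * F (φ₀ x) + m * F (φ₁ y)) :
    F (∫ x, φ x ∂(heatMeasurePi n t)) ≤
      l * F (∫ x, φ₀ x ∂(heatMeasurePi n t)) + m * F (∫ x, φ₁ x ∂(heatMeasurePi n t)) := by
  induction n with
  | zero =>
    rw [integral_heatMeasurePi_zero, integral_heatMeasurePi_zero, integral_heatMeasurePi_zero]
    simpa using h 0 0
  | succ n ih =>
    rw [integral_heatMeasurePi_succ (integrable_heatMeasurePi_of_lipschitz hφ hI t),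
      integral_heatMeasurePi_succ (integrable_heatMeasurePi_of_lipschitz hφ₀ hI₀ t),
      integral_heatMeasurePi_succ (integrable_heatMeasurePi_of_lipschitz hφ₁ hI₁ t)]
    have hcons := fun x => lipschitzWith_comp_cons hφ x
    have hcons₀ := fun x => lipschitzWith_comp_cons hφ₀ x
    have hcons₁ := fun x => lipschitzWith_comp_cons hφ₁ x
    refine ih (lipschitzWith_lineFlow_cons hφ hI t) (lipschitzWith_lineFlow_cons hφ₀ hI₀ t)
      (lipschitzWith_lineFlow_cons hφ₁ hI₁ t)
      (fun x => lineFlow_mem_Icc (hcons x).continuous.measurable (fun _ => hI _) t 0)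
      (fun x => lineFlow_mem_Icc (hcons₀ x).continuous.measurable (fun _ => hI₀ _) t 0)
      (fun x => lineFlow_mem_Icc (hcons₁ x).continuous.measurable (fun _ => hI₁ _) t 0)
      fun x y => ?_
    simpa using lineFlow_three_function hF hF' hl hm hlm hΛ hcb (hcons (l • x + m • y))
      (hcons₀ x) (hcons₁ y) (fun _ => hI _) (fun _ => hI₀ _) (fun _ => hI₁ _)
      (fun a b => by rw [cons_smul_add_smul]; exact h _ _) ht 0 0

/-! ### The inverse function -/

theorem apply_inverse {F : ℝ → ℝ} {z : ℝ} (hz : z ∈ imageSet F) : F (inverse F z) = z :=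
  Function.invFun_eq hz

section Inverse

variable {F : ℝ → ℝ} (hF : Admissible F)

include hF

theorem Admissible.inverse_apply (r : ℝ) : inverse F (F r) = r :=
  Function.leftInverse_invFun hF.strictMono.injective r

theorem Admissible.mem_imageSet_of_mem_Icc {a b z : ℝ} (hz : z ∈ Icc (F a) (F b)) :
    z ∈ imageSet F := by
  have hab : a ≤ b := hF.strictMono.le_iff_le.1 (hz.1.trans hz.2)
  obtain ⟨r, _, hr⟩ := intermediate_value_Icc hab hF.continuous.continuousOn hz
  exact ⟨r, hr⟩

theorem Admissible.mem_imageSet_of_le (htop : Tendsto F atTop atTop) {a z : ℝ} (hz : F a ≤ z) :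
    z ∈ imageSet F := by
  obtain ⟨b, hb⟩ := (htop.eventually_ge_atTop z).exists
  exact hF.mem_imageSet_of_mem_Icc ⟨hz, hb⟩

theorem Admissible.inverse_le_inverse {y z : ℝ} (hy : y ∈ imageSet F) (hz : z ∈ imageSet F)
    (h : y ≤ z) : inverse F y ≤ inverse F z := by
  rwa [← hF.strictMono.le_iff_le, apply_inverse hy, apply_inverse hz]

theorem Admissible.eventually_mem_imageSet (r : ℝ) : ∀ᶠ y in 𝓝 (F r), y ∈ imageSet F := by
  filter_upwards [Icc_mem_nhds (hF.strictMono (sub_one_lt r)) (hF.strictMono (lt_add_one r))]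
    with y hy using hF.mem_imageSet_of_mem_Icc hy

theorem Admissible.continuousAt_inverse {z : ℝ} (hz : z ∈ imageSet F) :
    ContinuousAt (inverse F) z := by
  obtain ⟨r, rfl⟩ := hz
  rw [ContinuousAt, hF.inverse_apply, Metric.tendsto_nhds]
  intro ε hε
  filter_upwards [hF.eventually_mem_imageSet r,
    Ioo_mem_nhds (hF.strictMono (sub_lt_self r hε)) (hF.strictMono (lt_add_of_pos_right r hε))]
  rintro _ ⟨s, rfl⟩ hs
  rw [hF.inverse_apply, Real.dist_eq, abs_sub_lt_iff]
  have hlower := hF.strictMono.lt_iff_lt.1 hs.1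
  have hupper := hF.strictMono.lt_iff_lt.1 hs.2
  constructor <;> linarith

theorem Admissible.hasDerivAt_inverse {r : ℝ} (hd : DifferentiableAt ℝ F r)
    (hr : deriv F r ≠ 0) : HasDerivAt (inverse F) (deriv F r)⁻¹ (F r) := by
  refine HasDerivAt.of_local_left_inverse (f := F) (hF.continuousAt_inverse ⟨r, rfl⟩) ?_ hr ?_
  · rw [hF.inverse_apply]
    exact hd.hasDerivAt
  · filter_upwards [hF.eventually_mem_imageSet r] with y hy using apply_inverse hy

theorem Admissible.eventually_hasDerivAt_inverse (h2 : ContDiff ℝ 2 F) {r : ℝ}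
    (hr : 0 < deriv F r) :
    ∀ᶠ z in 𝓝 (F r), HasDerivAt (inverse F) (deriv F (inverse F z))⁻¹ z := by
  have hcont : ContinuousAt (fun z => deriv F (inverse F z)) (F r) :=
    (h2.continuous_deriv one_le_two).continuousAt.comp (hF.continuousAt_inverse ⟨r, rfl⟩)
  have hpos : ∀ᶠ z in 𝓝 (F r), 0 < deriv F (inverse F z) :=
    hcont.eventually (lt_mem_nhds (by simpa only [hF.inverse_apply] using hr))
  filter_upwards [hpos, hF.eventually_mem_imageSet r] with z hz hzm
  have := hF.hasDerivAt_inverse (h2.differentiable two_ne_zero _) hz.ne'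
  rwa [apply_inverse hzm] at this

theorem Admissible.hasDerivAt_deriv_comp_inverse (h2 : ContDiff ℝ 2 F) {r : ℝ}
    (hr : 0 < deriv F r) :
    HasDerivAt (fun z => deriv F (inverse F z)) (deriv (deriv F) r * (deriv F r)⁻¹) (F r) := by
  refine HasDerivAt.comp (h₂ := deriv F) (F r) ?_
    (hF.hasDerivAt_inverse (h2.differentiable two_ne_zero _) hr.ne')
  rw [hF.inverse_apply]
  exact hasDerivAt_deriv_of_contDiff_two h2 r

theorem Admissible.hasDerivAt_log_deriv_inverse (h2 : ContDiff ℝ 2 F) {r : ℝ}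
    (hr : 0 < deriv F r) :
    HasDerivAt (fun z => Real.log (deriv (inverse F) z)) (gradCoeff F r) (F r) := by
  have hlog := ((hF.hasDerivAt_deriv_comp_inverse h2 hr).log
    (by rw [hF.inverse_apply]; exact hr.ne')).neg
  refine (hlog.congr_deriv ?_).congr_of_eventuallyEq ?_
  · rw [hF.inverse_apply, gradCoeff]
    field_simp
  · filter_upwards [hF.eventually_hasDerivAt_inverse h2 hr] with z hz
    rw [hz.deriv, Real.log_inv]
    rfl

theorem Admissible.logDerivInverse_apply (h2 : ContDiff ℝ 2 F) {r : ℝ} (hr : 0 < deriv F r) :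
    logDerivInverse F (F r) = gradCoeff F r :=
  (hF.hasDerivAt_log_deriv_inverse h2 hr).deriv

end Inverse

theorem exists_antilipschitz_on_Icc {F : ℝ → ℝ} (h2 : ContDiff ℝ 2 F)
    (hF' : ∀ r, 0 < deriv F r) (a b : ℝ) :
    ∃ c : ℝ≥0, ∀ r ∈ Icc a b, ∀ s ∈ Icc a b, dist r s ≤ c * dist (F r) (F s) := by
  rcases lt_or_ge b a with hab | hab
  · exact ⟨0, fun r hr => by simp [Icc_eq_empty_of_lt hab] at hr⟩
  obtain ⟨x, -, hx⟩ := isCompact_Icc.exists_isMinOn (nonempty_Icc.2 hab)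
    (h2.continuous_deriv one_le_two).continuousOn
  have hgrowth := (convex_Icc a b).mul_sub_le_image_sub_of_le_deriv h2.continuous.continuousOn
    (h2.differentiable two_ne_zero).differentiableOn (C := deriv F x)
    fun y hy => hx (interior_subset hy)
  have hpos := hF' x
  refine ⟨⟨(deriv F x)⁻¹, (inv_pos.2 hpos).le⟩, ?_⟩
  have hordered : ∀ r ∈ Icc a b, ∀ s ∈ Icc a b, r ≤ s →
      dist r s ≤ (deriv F x)⁻¹ * dist (F r) (F s) := by
    intro r hr s hs hrs
    rw [le_inv_mul_iff₀ hpos, dist_comm, dist_comm (F r), Real.dist_eq, Real.dist_eq,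
      abs_of_nonneg (sub_nonneg.2 hrs)]
    exact (hgrowth r hr s hs hrs).trans (le_abs_self _)
  intro r hr s hs
  rcases le_total r s with h | h
  · exact hordered r hr s hs h
  · rw [dist_comm, dist_comm (F r)]
    exact hordered s hs r hr h

theorem sub_le_mul_sub_of_convexOn {s : Set ℝ} {g : ℝ → ℝ} (hg : ConvexOn ℝ s g) {x y z K : ℝ}
    (hx : x ∈ s) (hz : z ∈ s) (hxy : x ≤ y) (hyz : y + 1 ≤ z) (hK : |g y| ≤ K) :
    g y - g x ≤ (|g z| + K) * (y - x) := by
  rcases hxy.eq_or_lt with rfl | hxy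
  · simp
  have hslope := hg.slope_mono_adjacent hx hz hxy (by linarith)
  have hbound : (g z - g y) / (z - y) ≤ |g z| + K := by
    rw [div_le_iff₀ (by linarith)]
    nlinarith [le_abs_self (g z), neg_abs_le (g y), abs_nonneg (g y), abs_nonneg (g z)]
  exact (div_le_iff₀ (by linarith)).1 (hslope.trans hbound)

theorem Admissible.exists_coeffBound {F : ℝ → ℝ} (hF : Admissible F) (h2 : ContDiff ℝ 2 F)
    (htop : Tendsto F atTop atTop) (hF' : ∀ r, 0 < deriv F r)
    (hg : ConvexOn ℝ (imageSet F) (logDerivInverse F)) (α β : ℝ) {l m : ℝ} (hl : 0 ≤ l)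
    (hm : 0 ≤ m) (hlm : l + m = 1) : ∃ Λ, 0 ≤ Λ ∧ CoeffBound F α β l m Λ := by
  have hgF := fun r => hF.logDerivInverse_apply h2 (hF' r)
  obtain ⟨K, hK⟩ := isCompact_Icc.exists_bound_of_continuousOn
    ((continuous_gradCoeff h2 hF').continuousOn (s := Icc α β))
  obtain ⟨ρ, hρ⟩ := hF.mem_imageSet_of_le htop (le_add_of_nonneg_right zero_le_one : F β ≤ F β + 1)
  refine ⟨|gradCoeff F ρ| + |K|, by positivity, fun r hr r₀ _ r₁ _ hle => ?_⟩
  have hcombo := hg.1 (mem_range_self r₀) (mem_range_self r₁) hl hm hlm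
  have hconv := hg.2 (mem_range_self r₀) (mem_range_self r₁) hl hm hlm
  have hrρ : F r + 1 ≤ F ρ := by
    rw [hρ]
    gcongr
    exact hF.strictMono.monotone hr.2
  have hlip := sub_le_mul_sub_of_convexOn hg hcombo (mem_range_self ρ) hle hrρ
    (K := |K|) (by rw [hgF]; exact (hK r hr).trans (le_abs_self K))
  simp only [smul_eq_mul, hgF] at hconv hlip
  linarith

/-! ### Lipschitz approximation from below -/

/-- The infimal convolution of `w` with `k * dist`, the largest `k`-Lipschitz function below `w`
when `w` is bounded from below. -/
def infConv {X : Type*} [PseudoMetricSpace X] (k : ℝ) (w : X → ℝ) (x : X) : ℝ :=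
  ⨅ y, (w y + k * dist x y)

section InfConv

variable {X : Type*} [PseudoMetricSpace X] {k b : ℝ} {w : X → ℝ}

theorem le_add_mul_dist (hk : 0 ≤ k) (hb : ∀ y, b ≤ w y) (x y : X) : b ≤ w y + k * dist x y :=
  (hb y).trans (le_add_of_nonneg_right (by positivity))

theorem infConv_le_add (hk : 0 ≤ k) (hb : ∀ y, b ≤ w y) (x y : X) :
    infConv k w x ≤ w y + k * dist x y :=
  ciInf_le ⟨b, forall_mem_range.2 (le_add_mul_dist hk hb x)⟩ y

theorem infConv_le (hk : 0 ≤ k) (hb : ∀ y, b ≤ w y) (x : X) : infConv k w x ≤ w x := by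
  simpa using infConv_le_add hk hb x x

theorem le_infConv (hk : 0 ≤ k) (hb : ∀ y, b ≤ w y) (x : X) : b ≤ infConv k w x :=
  have : Nonempty X := ⟨x⟩
  le_ciInf (le_add_mul_dist hk hb x)

theorem lipschitzWith_infConv {k : ℝ≥0} (hb : ∀ y, b ≤ w y) :
    LipschitzWith k (infConv k w) := by
  refine LipschitzWith.of_le_add_mul k fun x x' => ?_
  have : Nonempty X := ⟨x⟩
  rw [← sub_le_iff_le_add]
  refine le_ciInf fun y => ?_
  have hle := infConv_le_add k.coe_nonneg hb x y
  have htri := mul_le_mul_of_nonneg_left (dist_triangle x x' y) k.coe_nonneg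
  linarith

theorem tendsto_infConv_min (hw : Continuous w) (hb : ∀ y, b ≤ w y) {c : ℕ → ℝ}
    (hc : Tendsto c atTop atTop) (hcb : ∀ k, b ≤ c k) (x : X) :
    Tendsto (fun k : ℕ => infConv k (fun y => min (w y) (c k)) x) atTop (𝓝 (w x)) := by
  have : Nonempty X := ⟨x⟩
  rw [Metric.tendsto_nhds]
  intro ε hε
  obtain ⟨r, hr, hwr⟩ := Metric.continuousAt_iff.1 hw.continuousAt (ε / 2) (half_pos hε)
  filter_upwards [hc.eventually_ge_atTop (w x),
    (tendsto_natCast_atTop_atTop.atTop_mul_const hr).eventually_ge_atTop (w x - b)] with k hck hkr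
  have hmin : ∀ y, b ≤ min (w y) (c k) := fun y => le_min (hb y) (hcb k)
  have hupper := (infConv_le k.cast_nonneg hmin x).trans (min_le_left _ _)
  have hlower : w x - ε / 2 ≤ infConv k (fun y => min (w y) (c k)) x := by
    refine le_ciInf fun y => ?_
    rcases lt_or_ge (dist y x) r with hy | hy
    · have hwy := (abs_lt.1 (hwr hy)).1
      have hle : w x - ε / 2 ≤ min (w y) (c k) := le_min (by linarith) (by linarith)
      exact hle.trans (le_add_of_nonneg_right (by positivity))
    · have hfar : (k : ℝ) * r ≤ k * dist x y := by rw [dist_comm x]; gcongr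
      linarith [hmin y]
  rw [Real.dist_eq, abs_lt]
  constructor <;> linarith

theorem infConv_three_function {V : Type*} [SeminormedAddCommGroup V] [NormedSpace ℝ V]
    {l m : ℝ} {w w₀ w₁ : V → ℝ} (hk : 0 ≤ k) (hl : 0 ≤ l) (hm : 0 ≤ m)
    (hb : ∀ y, b ≤ w y) (h : ∀ x y, w (l • x + m • y) ≤ l * w₀ x + m * w₁ y) (x y : V) :
    infConv k w (l • x + m • y) ≤ l * infConv k w₀ x + m * infConv k w₁ y := by
  rw [infConv.eq_def k w₀, infConv.eq_def k w₁, Real.mul_iInf_of_nonneg hl,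
    Real.mul_iInf_of_nonneg hm]
  refine le_ciInf_add_ciInf fun x' y' => ?_
  have hdist : dist (l • x + m • y) (l • x' + m • y') ≤ l * dist x x' + m * dist y y' := by
    refine (dist_add_add_le _ _ _ _).trans ?_
    rw [dist_smul₀, dist_smul₀, Real.norm_of_nonneg hl, Real.norm_of_nonneg hm]
  linarith [infConv_le_add hk hb (l • x + m • y) (l • x' + m • y'), h x' y',
    mul_le_mul_of_nonneg_left hdist hk]

end InfConv

theorem min_three_function {b c c' l m w w₀ w₁ : ℝ} (hl : 0 ≤ l) (hm : 0 ≤ m)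
    (hbc : b ≤ c') (hc₀ : c ≤ l * c' + m * b) (hc₁ : c ≤ l * b + m * c') (hw₀ : b ≤ w₀)
    (hw₁ : b ≤ w₁) (h : w ≤ l * w₀ + m * w₁) :
    min w c ≤ l * min w₀ c' + m * min w₁ c' := by
  have hlw₀ : l * b ≤ l * w₀ := by gcongr
  have hmw₁ : m * b ≤ m * w₁ := by gcongr
  have hmc : m * b ≤ m * c' := by gcongr
  rcases le_total w₀ c' with h₀ | h₀ <;> rcases le_total w₁ c' with h₁ | h₁ <;>
    simp only [min_eq_left, min_eq_right, h₀, h₁]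
  · exact (min_le_left _ _).trans h
  all_goals exact (min_le_right _ _).trans (by linarith)

/-- Bounded continuous approximations of `φ` from below, obtained by truncating `F ∘ φ` at height
`c` and regularizing it to a `k`-Lipschitz function. -/
def lipApprox {X : Type*} [PseudoMetricSpace X] (F : ℝ → ℝ) (k : ℕ) (c : ℝ) (φ : X → ℝ) (x : X) :
    ℝ :=
  inverse F (infConv k (fun y => min (F (φ y)) c) x)

theorem apply_le_min {X : Type*} {F : ℝ → ℝ} {φ : X → ℝ} {a c : ℝ} (hF : Admissible F)
    (ha : ∀ x, a ≤ φ x) (hc : F a ≤ c) (x : X) : F a ≤ min (F (φ x)) c :=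
  le_min (hF.strictMono.monotone (ha x)) hc

section LipApprox

variable {X : Type*} [PseudoMetricSpace X] {F : ℝ → ℝ} {φ : X → ℝ} {a c : ℝ}
  (hF : Admissible F) (ha : ∀ x, a ≤ φ x)

include hF ha

theorem infConv_min_mem_Icc (hc : F a ≤ c) (k : ℕ) (x : X) :
    infConv k (fun y => min (F (φ y)) c) x ∈ Icc (F a) (min (F (φ x)) c) :=
  ⟨le_infConv k.cast_nonneg (apply_le_min hF ha hc) x,
    infConv_le k.cast_nonneg (apply_le_min hF ha hc) x⟩

theorem infConv_min_mem_imageSet (hc : F a ≤ c) (k : ℕ) (x : X) :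
    infConv k (fun y => min (F (φ y)) c) x ∈ imageSet F :=
  have h := infConv_min_mem_Icc hF ha hc k x
  hF.mem_imageSet_of_mem_Icc ⟨h.1, h.2.trans (min_le_left _ _)⟩

theorem apply_lipApprox (hc : F a ≤ c) (k : ℕ) (x : X) :
    F (lipApprox F k c φ x) = infConv k (fun y => min (F (φ y)) c) x :=
  apply_inverse (infConv_min_mem_imageSet hF ha hc k x)

theorem lipApprox_le (hc : F a ≤ c) (k : ℕ) (x : X) : lipApprox F k c φ x ≤ φ x := by
  rw [← hF.strictMono.le_iff_le, apply_lipApprox hF ha hc]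
  exact (infConv_min_mem_Icc hF ha hc k x).2.trans (min_le_left _ _)

theorem lipApprox_mem_Icc (hc : F a ≤ c) (k : ℕ) {β : ℝ} (hβ : c ≤ F β) (x : X) :
    lipApprox F k c φ x ∈ Icc a β := by
  have h := infConv_min_mem_Icc hF ha hc k x
  rw [← apply_lipApprox hF ha hc] at h
  exact ⟨hF.strictMono.le_iff_le.1 h.1,
    hF.strictMono.le_iff_le.1 (h.2.trans ((min_le_right _ _).trans hβ))⟩

theorem continuous_lipApprox (hc : F a ≤ c) (k : ℕ) : Continuous (lipApprox F k c φ) :=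
  continuous_iff_continuousAt.2 fun x =>
    (hF.continuousAt_inverse (infConv_min_mem_imageSet hF ha hc k x)).comp
      (lipschitzWith_infConv (k := (k : ℝ≥0)) (apply_le_min hF ha hc)).continuous.continuousAt

theorem lipschitzWith_lipApprox (hc : F a ≤ c) (k : ℕ) {β : ℝ} (hβ : c ≤ F β) {C : ℝ≥0}
    (hC : ∀ r ∈ Icc a β, ∀ s ∈ Icc a β, dist r s ≤ C * dist (F r) (F s)) :
    LipschitzWith (C * k) (lipApprox F k c φ) := by
  refine LipschitzWith.of_dist_le_mul fun x y => ?_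
  refine (hC _ (lipApprox_mem_Icc hF ha hc k hβ x) _ (lipApprox_mem_Icc hF ha hc k hβ y)).trans ?_
  rw [apply_lipApprox hF ha hc, apply_lipApprox hF ha hc, NNReal.coe_mul, mul_assoc]
  gcongr
  exact (lipschitzWith_infConv (k := (k : ℝ≥0)) (apply_le_min hF ha hc)).dist_le_mul x y

theorem tendsto_lipApprox (hφ : Continuous φ) {c : ℕ → ℝ} (hc : ∀ k, F a ≤ c k)
    (hct : Tendsto c atTop atTop) (x : X) :
    Tendsto (fun k => lipApprox F k (c k) φ x) atTop (𝓝 (φ x)) := by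
  have hlim := (hF.continuousAt_inverse ⟨φ x, rfl⟩).tendsto.comp <|
    tendsto_infConv_min (hF.continuous.comp hφ) (fun y => hF.strictMono.monotone (ha y)) hct hc x
  rwa [hF.inverse_apply] at hlim

theorem tendsto_integral_lipApprox [MeasurableSpace X] [OpensMeasurableSpace X] {μ : Measure X}
    [IsFiniteMeasure μ] (hφ : Continuous φ) (hint : Integrable φ μ) {c : ℕ → ℝ}
    (hc : ∀ k, F a ≤ c k) (hct : Tendsto c atTop atTop) :
    Tendsto (fun k => ∫ x, lipApprox F k (c k) φ x ∂μ) atTop (𝓝 (∫ x, φ x ∂μ)) := by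
  refine tendsto_integral_of_dominated_convergence (fun x => |a| + |φ x|)
    (fun k => (continuous_lipApprox hF ha (hc k) k).aestronglyMeasurable)
    ((integrable_const _).add hint.abs) (fun k => ae_of_all _ fun x => ?_)
    (ae_of_all _ fun x => tendsto_lipApprox hF ha hφ hc hct x)
  have hlower : a ≤ lipApprox F k (c k) φ x := by
    rw [← hF.strictMono.le_iff_le, apply_lipApprox hF ha (hc k)]
    exact (infConv_min_mem_Icc hF ha (hc k) k x).1
  exact (abs_le_max_abs_abs hlower (lipApprox_le hF ha (hc k) k x)).trans
    (max_le_add_of_nonneg (abs_nonneg _) (abs_nonneg _))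

end LipApprox

theorem lipApprox_three_function {V : Type*} [SeminormedAddCommGroup V] [NormedSpace ℝ V]
    {F : ℝ → ℝ} (hF : Admissible F) {a c c' l m : ℝ} (hl : 0 ≤ l) (hm : 0 ≤ m) (hc : F a ≤ c)
    (hc' : F a ≤ c') (hc₀ : c ≤ l * c' + m * F a) (hc₁ : c ≤ l * F a + m * c')
    {φ φ₀ φ₁ : V → ℝ} (ha : ∀ x, a ≤ φ x) (ha₀ : ∀ x, a ≤ φ₀ x) (ha₁ : ∀ x, a ≤ φ₁ x)
    (h : ∀ x y, F (φ (l • x + m • y)) ≤ l * F (φ₀ x) + m * F (φ₁ y)) (k : ℕ) (x y : V) :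
    F (lipApprox F k c φ (l • x + m • y)) ≤
      l * F (lipApprox F k c' φ₀ x) + m * F (lipApprox F k c' φ₁ y) := by
  rw [apply_lipApprox hF ha hc, apply_lipApprox hF ha₀ hc', apply_lipApprox hF ha₁ hc']
  exact infConv_three_function k.cast_nonneg hl hm (apply_le_min hF ha hc)
    (fun x y => min_three_function hl hm hc' hc₀ hc₁ (hF.strictMono.monotone (ha₀ x))
      (hF.strictMono.monotone (ha₁ y)) (h x y)) x y

theorem FConvex.continuous {n : ℕ} {F : ℝ → ℝ} (hF : Admissible F) {φ : E n → ℝ}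
    (h : FConvex F φ) : Continuous φ := by
  have hcomp : Continuous fun x => F (φ x) :=
    continuousOn_univ.1 (ConvexOn.continuousOn isOpen_univ h)
  rw [show φ = fun x => inverse F (F (φ x)) from funext fun x => (hF.inverse_apply _).symm]
  exact continuous_iff_continuousAt.2 fun x =>
    (hF.continuousAt_inverse ⟨φ x, rfl⟩).comp (f := fun x => F (φ x)) hcomp.continuousAt

/-! ### Sufficiency of the convexity of `g_F` -/

section Sufficiency

variable {n : ℕ} {F : ℝ → ℝ} (hF : Admissible F) (h2 : ContDiff ℝ 2 F)
  (htop : Tendsto F atTop atTop) (hF' : ∀ r, 0 < deriv F r)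
  (hg : ConvexOn ℝ (imageSet F) (logDerivInverse F))

include hF h2 htop hF' hg

theorem integral_lipApprox_three_function {a c c' l m t : ℝ} (hl : 0 ≤ l) (hm : 0 ≤ m)
    (hlm : l + m = 1) (ht : 0 ≤ t) (hc : F a ≤ c) (hc' : F a ≤ c')
    (hc₀ : c ≤ l * c' + m * F a) (hc₁ : c ≤ l * F a + m * c') {φ φ₀ φ₁ : (Fin n → ℝ) → ℝ}
    (ha : ∀ x, a ≤ φ x) (ha₀ : ∀ x, a ≤ φ₀ x) (ha₁ : ∀ x, a ≤ φ₁ x)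
    (hint₀ : Integrable φ₀ (heatMeasurePi n t)) (hint₁ : Integrable φ₁ (heatMeasurePi n t))
    (h : ∀ x y, F (φ (l • x + m • y)) ≤ l * F (φ₀ x) + m * F (φ₁ y)) (k : ℕ) :
    F (∫ x, lipApprox F k c φ x ∂(heatMeasurePi n t)) ≤
      l * F (∫ x, φ₀ x ∂(heatMeasurePi n t)) + m * F (∫ x, φ₁ x ∂(heatMeasurePi n t)) := by
  obtain ⟨β, hβ⟩ := (htop.eventually_ge_atTop (max c c')).exists
  obtain ⟨C, hC⟩ := exists_antilipschitz_on_Icc h2 hF' a β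
  obtain ⟨Λ, hΛ, hcb⟩ := hF.exists_coeffBound h2 htop hF' hg a β hl hm hlm
  have hβc := (le_max_left _ _).trans hβ
  have hβc' := (le_max_right _ _).trans hβ
  have hlip₀ := lipschitzWith_lipApprox hF ha₀ hc' k hβc' hC
  have hlip₁ := lipschitzWith_lipApprox hF ha₁ hc' k hβc' hC
  have hI₀ := lipApprox_mem_Icc hF ha₀ hc' k hβc'
  have hI₁ := lipApprox_mem_Icc hF ha₁ hc' k hβc'
  have hmono₀ := integral_mono (integrable_heatMeasurePi_of_lipschitz hlip₀ hI₀ t) hint₀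
    (lipApprox_le hF ha₀ hc' k)
  have hmono₁ := integral_mono (integrable_heatMeasurePi_of_lipschitz hlip₁ hI₁ t) hint₁
    (lipApprox_le hF ha₁ hc' k)
  exact (gaussian_three_function h2 hF' hl hm hlm hΛ hcb ht
      (lipschitzWith_lipApprox hF ha hc k hβc hC) hlip₀ hlip₁
      (lipApprox_mem_Icc hF ha hc k hβc) hI₀ hI₁
      (lipApprox_three_function hF hl hm hc hc' hc₀ hc₁ ha ha₀ ha₁ h k)).trans
    (add_le_add (mul_le_mul_of_nonneg_left (hF.strictMono.monotone hmono₀) hl)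
      (mul_le_mul_of_nonneg_left (hF.strictMono.monotone hmono₁) hm))

theorem integral_three_function {l m t a : ℝ} (hl : 0 < l) (hm : 0 < m) (hlm : l + m = 1)
    (ht : 0 ≤ t) {φ φ₀ φ₁ : (Fin n → ℝ) → ℝ} (hφ : Continuous φ)
    (hint : Integrable φ (heatMeasurePi n t)) (hint₀ : Integrable φ₀ (heatMeasurePi n t))
    (hint₁ : Integrable φ₁ (heatMeasurePi n t)) (ha : ∀ x, a ≤ φ x) (ha₀ : ∀ x, a ≤ φ₀ x)
    (ha₁ : ∀ x, a ≤ φ₁ x) (h : ∀ x y, F (φ (l • x + m • y)) ≤ l * F (φ₀ x) + m * F (φ₁ y)) :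
    F (∫ x, φ x ∂(heatMeasurePi n t)) ≤
      l * F (∫ x, φ₀ x ∂(heatMeasurePi n t)) + m * F (∫ x, φ₁ x ∂(heatMeasurePi n t)) := by
  have hlevel : ∀ k : ℕ, F a ≤ F a + k := fun k => le_add_of_nonneg_right k.cast_nonneg
  have hlim := tendsto_integral_lipApprox hF ha hφ hint hlevel
    (tendsto_atTop_add_const_left _ _ tendsto_natCast_atTop_atTop)
  refine le_of_tendsto' ((hF.continuous.tendsto _).comp hlim) fun k => ?_
  have hk : (0 : ℝ) ≤ k := k.cast_nonneg
  have hsplit : l * F a + m * F a = F a := by rw [← add_mul, hlm, one_mul]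
  -- `φ₀` and `φ₁` are truncated higher than `φ`, at `F a + k / (l m)`: there either term of the
  -- convex combination alone makes up for the truncation of `F ∘ φ` at `F a + k`.
  have hl' : l * (k / (l * m)) = k / m := by field_simp
  have hm' : m * (k / (l * m)) = k / l := by field_simp
  have hkm : (k : ℝ) ≤ k / m := le_div_self hk hm (by linarith)
  have hkl : (k : ℝ) ≤ k / l := le_div_self hk hl (by linarith)
  exact integral_lipApprox_three_function hF h2 htop hF' hg (c' := F a + k / (l * m)) hl.le hm.le
    hlm ht (hlevel k) (le_add_of_nonneg_right (by positivity)) (by rw [mul_add]; linarith)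
    (by rw [mul_add]; linarith) ha ha₀ ha₁ hint₀ hint₁ h k

theorem preserved_of_convexOn : Preserved n F := by
  rintro φ ⟨a, ha⟩ hφ - t ht htT
  have ha' : ∀ x, a ≤ φ x := fun x => ha (mem_range_self x)
  have hint := integrable_of_lt_existenceTime ht htT
  refine convexOn_iff_forall_pos.2 ⟨convex_univ, fun x _ y _ l m hl hm hlm => ?_⟩
  simp only [heatFlow_eq_integral ht, smul_eq_mul]
  refine integral_three_function hF h2 htop hF' hg hl hm hlm ht.le
    ((hφ.continuous hF).comp (continuous_const.add (PiLp.continuous_toLp 2 _))) (hint _) (hint x)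
    (hint y) (fun _ => ha' _) (fun _ => ha' _) (fun _ => ha' _) fun z z' => ?_
  have hshift : l • x + m • y + WithLp.toLp 2 (l • z + m • z') =
      l • (x + WithLp.toLp 2 z) + m • (y + WithLp.toLp 2 z') := by
    simp only [WithLp.toLp_add, WithLp.toLp_smul, smul_add]
    abel
  rw [hshift]
  exact hφ.2 (mem_univ _) (mem_univ _) hl.le hm.le hlm

end Sufficiency

/-! ### Triviality -/

theorem add_mul_sub_le_of_convexOn {V : Type*} [AddCommGroup V] [Module ℝ V] {w : V → ℝ}
    (hw : ConvexOn ℝ univ w) (x y : V) {s : ℝ} (hs : 1 ≤ s) :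
    w x + s * (w y - w x) ≤ w (x + s • (y - x)) := by
  have hs0 : 0 < s := by linarith
  have hy : (1 - s⁻¹) • x + s⁻¹ • (x + s • (y - x)) = y := by
    rw [smul_add, inv_smul_smul₀ hs0.ne', sub_smul, one_smul]
    abel
  have h := hw.2 (mem_univ x) (mem_univ (x + s • (y - x)))
    (sub_nonneg.2 (inv_le_one_of_one_le₀ hs)) (inv_nonneg.2 hs0.le) (sub_add_cancel _ _)
  rw [hy, smul_eq_mul, smul_eq_mul, ← mul_le_mul_iff_right₀ hs0, mul_add,
    mul_inv_cancel_left₀ hs0.ne', ← mul_assoc, mul_sub, mul_one, mul_inv_cancel₀ hs0.ne'] at h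
  linarith

theorem eq_of_convexOn_of_le {V : Type*} [AddCommGroup V] [Module ℝ V] {w : V → ℝ}
    (hw : ConvexOn ℝ univ w) {M : ℝ} (hM : ∀ x, w x ≤ M) (x y : V) : w x = w y := by
  suffices hle : ∀ x y, w y ≤ w x from le_antisymm (hle y x) (hle x y)
  intro x y
  by_contra! hlt
  have hd : 0 < w y - w x := sub_pos.2 hlt
  have hs : 1 ≤ (M - w x) / (w y - w x) + 1 :=
    le_add_of_nonneg_left (div_nonneg (sub_nonneg.2 (hM x)) hd.le)
  have hgrow := (add_mul_sub_le_of_convexOn hw x y hs).trans (hM _)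
  rw [add_mul, div_mul_cancel₀ _ hd.ne'] at hgrow
  linarith

theorem FConvex.exists_eq_const_of_tendsto_nhds {n : ℕ} {F : ℝ → ℝ} {φ : E n → ℝ}
    (hφ : FConvex F φ) (hF : Admissible F) {L : ℝ} (hL : Tendsto F atTop (𝓝 L)) :
    ∃ c, ∀ x, φ x = c := by
  refine ⟨φ 0, fun x => hF.strictMono.injective ?_⟩
  exact eq_of_convexOn_of_le hφ (fun x => hF.strictMono.monotone.ge_of_tendsto hL (φ x)) x 0

theorem Admissible.le_inverse {F : ℝ → ℝ} (hF : Admissible F) (htop : Tendsto F atTop atTop)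
    {r z : ℝ} (h : F r ≤ z) : r ≤ inverse F z := by
  rwa [← hF.strictMono.le_iff_le, apply_inverse (hF.mem_imageSet_of_le htop h)]

theorem integrable_exp_mul_of_integrable_heatMeasure {ψ : ℝ → ℝ} {t : ℝ} (ht : 0 < t)
    (h : Integrable ψ (heatMeasure t)) :
    Integrable fun s => Real.exp (-s ^ 2 / (4 * t)) * ψ s := by
  rw [heatMeasure, gaussianReal_of_var_ne_zero _ (toNNReal_two_mul_ne_zero ht),
    integrable_withDensity_iff_integrable_smul' (measurable_gaussianPDF _ _)
      (ae_of_all _ fun _ => gaussianPDF_lt_top)] at h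
  refine (h.const_mul (Real.sqrt (2 * Real.pi * (2 * t)))).congr (ae_of_all _ fun s => ?_)
  have hsqrt : Real.sqrt (2 * Real.pi * (2 * t)) ≠ 0 := Real.sqrt_ne_zero'.2 (by positivity)
  simp only [toReal_gaussianPDF, gaussianPDFReal, Real.coe_toNNReal (2 * t) (by positivity),
    smul_eq_mul, sub_zero]
  rw [mul_assoc (Real.sqrt _)⁻¹, mul_inv_cancel_left₀ hsqrt, ← mul_assoc 2 2 t]
  norm_num

theorem exp_neg_mul_sq_le {t : ℝ} (ht : 0 < t) (p q z : ℝ) :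
    Real.exp (-(p ^ 2 / (2 * t)) * z ^ 2) ≤
      Real.exp (q ^ 2 / (2 * t)) * Real.exp (-(p * z + q) ^ 2 / (4 * t)) := by
  have hsquare : q ^ 2 / (2 * t) + -(p * z + q) ^ 2 / (4 * t) =
      -(p ^ 2 / (2 * t)) * z ^ 2 + (p * z - q) ^ 2 / (4 * t) := by field_simp; ring
  rw [← Real.exp_add, Real.exp_le_exp, hsquare]
  exact le_add_of_nonneg_right (by positivity)

theorem Admissible.gaussIntegral_lt_top_of_tail {F : ℝ → ℝ} (hF : Admissible F)
    (htop : Tendsto F atTop atTop) {A Z : ℝ} (hA : 0 ≤ A)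
    (hZ : ∫⁻ z in Ici Z, ENNReal.ofReal (Real.exp (-A * z ^ 2) * inverse F z) < ⊤) :
    gaussIntegral F A < ⊤ := by
  have hbound : ∀ z ∈ Icc (F 1) Z, Real.exp (-A * z ^ 2) * inverse F z ≤ inverse F Z := by
    intro z hz
    have hexp : Real.exp (-A * z ^ 2) ≤ 1 :=
      Real.exp_le_one_iff.2 (mul_nonpos_of_nonpos_of_nonneg (neg_nonpos.2 hA) (sq_nonneg z))
    have hone : 1 ≤ inverse F z := hF.le_inverse htop hz.1
    have hmono : inverse F z ≤ inverse F Z := hF.inverse_le_inverse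
      (hF.mem_imageSet_of_le htop hz.1) (hF.mem_imageSet_of_le htop (hz.1.trans hz.2)) hz.2
    exact (mul_le_of_le_one_left (by linarith) hexp).trans hmono
  have hcompact : ∫⁻ z in Icc (F 1) Z, ENNReal.ofReal (Real.exp (-A * z ^ 2) * inverse F z) < ⊤ :=
    (setLIntegral_mono' measurableSet_Icc fun z hz =>
      ENNReal.ofReal_le_ofReal (hbound z hz)).trans_lt <| by
        rw [setLIntegral_const, Real.volume_Icc]
        exact ENNReal.mul_lt_top ENNReal.ofReal_lt_top ENNReal.ofReal_lt_top
  have hsplit : Ici (F 1) ⊆ Icc (F 1) Z ∪ Ici Z := fun z hz =>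
    (le_total z Z).imp (fun h => ⟨hz, h⟩) id
  exact (lintegral_mono_set hsplit).trans_lt
    ((lintegral_union_le _ _ _).trans_lt (ENNReal.add_lt_top.2 ⟨hcompact, hZ⟩))

theorem gaussIntegral_lt_top_of_le {F : ℝ → ℝ} (hF : Admissible F) (htop : Tendsto F atTop atTop)
    {ψ : ℝ → ℝ} {t : ℝ} (ht : 0 < t) (hψ : Integrable ψ (heatMeasure t)) {p q Z : ℝ} (hp : p ≠ 0)
    (hZ : F 1 ≤ Z) (hle : ∀ z, Z ≤ z → inverse F z ≤ ψ (p * z + q)) :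
    gaussIntegral F (p ^ 2 / (2 * t)) < ⊤ := by
  have hint : Integrable fun z => Real.exp (q ^ 2 / (2 * t)) *
      (Real.exp (-(p * z + q) ^ 2 / (4 * t)) * ψ (p * z + q)) :=
    (((integrable_exp_mul_of_integrable_heatMeasure ht hψ).comp_add_right q).comp_mul_left'
      hp).const_mul _
  have hbound : ∀ z ∈ Ici Z, Real.exp (-(p ^ 2 / (2 * t)) * z ^ 2) * inverse F z ≤
      Real.exp (q ^ 2 / (2 * t)) * (Real.exp (-(p * z + q) ^ 2 / (4 * t)) * ψ (p * z + q)) := by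
    intro z hz
    have hone : 1 ≤ inverse F z := hF.le_inverse htop (hZ.trans hz)
    rw [← mul_assoc]
    exact mul_le_mul (exp_neg_mul_sq_le ht p q z) (hle z hz) (by linarith) (by positivity)
  refine hF.gaussIntegral_lt_top_of_tail htop (Z := Z) (by positivity) ?_
  refine (setLIntegral_mono' measurableSet_Ici fun z hz => (ENNReal.ofReal_le_ofReal
    (hbound z hz)).trans (Real.ofReal_le_enorm _)).trans_lt ?_
  exact (setLIntegral_le_lintegral _ _).trans_lt hint.2

theorem eq_of_convexOn_of_integrable_heatMeasure {F : ℝ → ℝ} (hF : Admissible F)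
    (htop : Tendsto F atTop atTop) (hA : ∀ A : ℝ, 0 < A → gaussIntegral F A = ⊤) {ψ : ℝ → ℝ}
    (hψ : ConvexOn ℝ univ fun s => F (ψ s)) {t : ℝ} (ht : 0 < t)
    (hint : Integrable ψ (heatMeasure t)) (s₀ s₁ : ℝ) : ψ s₀ = ψ s₁ := by
  suffices hle : ∀ s₀ s₁, ψ s₁ ≤ ψ s₀ from le_antisymm (hle s₁ s₀) (hle s₀ s₁)
  intro s₀ s₁
  by_contra! hlt
  have hs : s₁ - s₀ ≠ 0 := sub_ne_zero.2 (by rintro rfl; exact lt_irrefl _ hlt)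
  set k := F (ψ s₁) - F (ψ s₀) with hk
  have hkpos : 0 < k := sub_pos.2 (hF.strictMono hlt)
  -- `p z + q = s₀ + ((z - F (ψ s₀)) / k) (s₁ - s₀)` is where the chord of `F ∘ ψ` through
  -- `s₀` and `s₁` has height `z`.
  set p := (s₁ - s₀) / k with hp
  set q := s₀ - F (ψ s₀) * p with hq
  have hp0 : p ≠ 0 := div_ne_zero hs hkpos.ne'
  have hchord : ∀ z, max (F 1) (F (ψ s₁)) ≤ z → inverse F z ≤ ψ (p * z + q) := by
    intro z hz
    have hfar : 1 ≤ (z - F (ψ s₀)) / k := by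
      rw [one_le_div hkpos]
      exact sub_le_sub_right ((le_max_right _ _).trans hz) _
    have hgrow := add_mul_sub_le_of_convexOn hψ s₀ s₁ hfar
    rw [← hk, div_mul_cancel₀ _ hkpos.ne', add_sub_cancel, smul_eq_mul,
      show s₀ + (z - F (ψ s₀)) / k * (s₁ - s₀) = p * z + q by rw [hq, hp]; ring] at hgrow
    rwa [← hF.strictMono.le_iff_le,
      apply_inverse (hF.mem_imageSet_of_le htop ((le_max_left _ _).trans hz))]
  have hfinite := gaussIntegral_lt_top_of_le hF htop ht hint hp0 (le_max_left _ _) hchord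
  exact hfinite.ne (hA _ (by positivity))

theorem isOpenPosMeasure_heatMeasurePi (n : ℕ) {t : ℝ} (ht : 0 < t) :
    (heatMeasurePi n t).IsOpenPosMeasure := by
  have : (heatMeasure t).IsOpenPosMeasure :=
    (gaussianReal_absolutelyContinuous' 0 (toNNReal_two_mul_ne_zero ht)).isOpenPosMeasure
  unfold heatMeasurePi
  infer_instance

theorem FConvex.convexOn_insertNth {n : ℕ} {F : ℝ → ℝ} {φ : E (n + 1) → ℝ} (hφ : FConvex F φ)
    (i : Fin (n + 1)) (x : Fin n → ℝ) :
    ConvexOn ℝ univ fun s : ℝ => F (φ (WithLp.toLp 2 (i.insertNth s x))) := by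
  refine ⟨convex_univ, fun s _ s' _ l m hl hm hlm => ?_⟩
  have hline : (WithLp.toLp 2 (i.insertNth (l • s + m • s') x) : E (n + 1)) =
      l • WithLp.toLp 2 (i.insertNth s x) + m • WithLp.toLp 2 (i.insertNth s' x) := by
    ext j
    cases j using Fin.succAboveCases i <;> simp [← add_mul, hlm]
  simp only [hline]
  exact hφ.2 (mem_univ _) (mem_univ _) hl hm hlm

theorem eq_of_forall_insertNth_eq {α β : Type*} {n : ℕ} {Φ : (Fin (n + 1) → α) → β}
    (h : ∀ i x s₀ s₁, Φ (Fin.insertNth i s₀ x) = Φ (Fin.insertNth i s₁ x))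
    (x y : Fin (n + 1) → α) : Φ x = Φ y := by
  have hupdate : ∀ (z : Fin (n + 1) → α) i v, Φ (Function.update z i v) = Φ z := by
    intro z i v
    have hi := h i (i.removeNth z) v (z i)
    rwa [Fin.insertNth_removeNth, Fin.insertNth_self_removeNth] at hi
  have hpiecewise : ∀ s : Finset (Fin (n + 1)), Φ (s.piecewise x y) = Φ y := by
    intro s
    induction s using Finset.induction_on with
    | empty => rw [Finset.piecewise_empty]
    | insert i s _ ih => rw [Finset.piecewise_insert, hupdate, ih]
  simpa using hpiecewise Finset.univ

theorem ae_integrable_insertNth {n : ℕ} {t : ℝ} {Φ : (Fin (n + 1) → ℝ) → ℝ}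
    (hΦ : Integrable Φ (heatMeasurePi (n + 1) t)) (i : Fin (n + 1)) :
    ∀ᵐ x ∂(heatMeasurePi n t), Integrable (fun s => Φ (i.insertNth s x)) (heatMeasure t) :=
  have hmp := (measurePreserving_piFinSuccAbove (fun _ : Fin (n + 1) => heatMeasure t) i).symm
  ((hmp.integrable_comp_emb (MeasurableEquiv.measurableEmbedding _)).2 hΦ).prod_left_ae

theorem forall_insertNth_eq_of_ae {n : ℕ} {μ : Measure (Fin n → ℝ)} [μ.IsOpenPosMeasure]
    {Φ : (Fin (n + 1) → ℝ) → ℝ} (hΦ : Continuous Φ) {i : Fin (n + 1)}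
    (h : ∀ᵐ x ∂μ, ∀ s₀ s₁, Φ (i.insertNth s₀ x) = Φ (i.insertNth s₁ x)) (x : Fin n → ℝ)
    (s₀ s₁ : ℝ) : Φ (i.insertNth s₀ x) = Φ (i.insertNth s₁ x) := by
  have hclosed : IsClosed {x : Fin n → ℝ | Φ (i.insertNth s₀ x) = Φ (i.insertNth s₁ x)} :=
    isClosed_eq (by fun_prop) (by fun_prop)
  exact hclosed.closure_subset (Measure.dense_of_ae (h.mono fun _ hx => hx s₀ s₁) x)

theorem FConvex.exists_eq_const_of_gaussIntegral_eq_top {n : ℕ} (hn : 1 ≤ n) {F : ℝ → ℝ}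
    {φ : E n → ℝ} (hφ : FConvex F φ) (hF : Admissible F) (htop : Tendsto F atTop atTop)
    (hA : ∀ A : ℝ, 0 < A → gaussIntegral F A = ⊤) (hT : 0 < existenceTime φ) :
    ∃ c, ∀ x, φ x = c := by
  obtain ⟨n, rfl⟩ := Nat.exists_eq_add_of_le' hn
  obtain ⟨t, ht, htT⟩ := exists_pos_ofReal_lt hT
  have hint := integrable_of_lt_existenceTime ht htT 0
  simp only [zero_add] at hint
  have := isOpenPosMeasure_heatMeasurePi n ht
  have hcont : Continuous fun z => φ (WithLp.toLp 2 z) :=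
    (hφ.continuous hF).comp (PiLp.continuous_toLp 2 _)
  have hlines : ∀ (i : Fin (n + 1)) (x : Fin n → ℝ) (s₀ s₁ : ℝ),
      φ (WithLp.toLp 2 (i.insertNth s₀ x)) = φ (WithLp.toLp 2 (i.insertNth s₁ x)) := fun i =>
    forall_insertNth_eq_of_ae hcont <| (ae_integrable_insertNth hint i).mono fun x hx =>
      eq_of_convexOn_of_integrable_heatMeasure hF htop hA (hφ.convexOn_insertNth i x) ht hx
  exact ⟨φ 0, fun x => eq_of_forall_insertNth_eq (Φ := fun z => φ (WithLp.toLp 2 z)) hlines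
    x.ofLp 0⟩

/-! ### Short-time asymptotics of the heat flow -/

theorem integrable_one_add_sq_mul_exp :
    Integrable (fun z : ℝ => (1 + z ^ 2) * Real.exp (z ^ 2 / 4)) (gaussianReal 0 1) := by
  rw [gaussianReal_of_var_ne_zero _ one_ne_zero, integrable_withDensity_iff_integrable_smul'
    (measurable_gaussianPDF _ _) (ae_of_all _ fun _ => gaussianPDF_lt_top)]
  refine ((integrable_momentMajorant 2 one_half_pos).const_mul
    (Real.sqrt (2 * Real.pi * 1))⁻¹).mono' (by simp only [toReal_gaussianPDF]; fun_prop)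
    (ae_of_all _ fun z => ?_)
  have hsq : 1 + z ^ 2 ≤ (1 + |z|) ^ 2 := by nlinarith [abs_nonneg z, sq_abs z]
  have hexp : Real.exp (-z ^ 2 / (2 * 1)) * Real.exp (z ^ 2 / 4) =
      Real.exp (-(1 / (8 * (1 / 2))) * z ^ 2) := by
    rw [← Real.exp_add]; ring_nf
  rw [Real.norm_of_nonneg (smul_nonneg ENNReal.toReal_nonneg (by positivity))]
  simp only [toReal_gaussianPDF, gaussianPDFReal, smul_eq_mul, sub_zero, NNReal.coe_one]
  rw [momentMajorant, mul_assoc, mul_left_comm (Real.exp _), hexp]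
  gcongr

theorem integral_sq_gaussianReal : ∫ z, z ^ 2 ∂(gaussianReal 0 1) = 1 := by
  have h := variance_id_gaussianReal (μ := 0) (v := 1)
  rw [variance_eq_integral aemeasurable_id] at h
  simpa using h

theorem eventually_pos_and_mul_lt_one (b : ℝ) : ∀ᶠ t in 𝓝[>] (0 : ℝ), 0 < t ∧ b * t < 1 := by
  have hlim : Tendsto (fun t => b * t) (𝓝 0) (𝓝 0) :=
    Continuous.tendsto' (by fun_prop) 0 0 (by simp)
  filter_upwards [self_mem_nhdsWithin,
    (hlim.mono_left nhdsWithin_le_nhds).eventually_lt_const one_pos] with t ht hbt using ⟨ht, hbt⟩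

section Rescaling

variable {f : ℝ → ℝ} {C b t : ℝ}

theorem abs_comp_sqrt_mul_le (hf : ∀ h, |f h| ≤ C * Real.exp (b * h ^ 2)) (ht : 0 ≤ t)
    (hbt : 8 * b * t ≤ 1) (z : ℝ) : |f (Real.sqrt (2 * t) * z)| ≤ C * Real.exp (z ^ 2 / 4) := by
  have hC : 0 ≤ C := by simpa using (abs_nonneg _).trans (hf 0)
  refine (hf _).trans (mul_le_mul_of_nonneg_left (Real.exp_le_exp.2 ?_) hC)
  rw [mul_pow, Real.sq_sqrt (by linarith)]
  nlinarith [sq_nonneg z]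

theorem abs_sq_mul_comp_sqrt_mul_le (hf : ∀ h, |f h| ≤ C * Real.exp (b * h ^ 2)) (ht : 0 ≤ t)
    (hbt : 8 * b * t ≤ 1) (z : ℝ) :
    |z ^ 2 * f (Real.sqrt (2 * t) * z)| ≤ C * ((1 + z ^ 2) * Real.exp (z ^ 2 / 4)) := by
  calc |z ^ 2 * f (Real.sqrt (2 * t) * z)| = z ^ 2 * |f (Real.sqrt (2 * t) * z)| := by
        rw [abs_mul, abs_of_nonneg (sq_nonneg z)]
    _ ≤ (1 + z ^ 2) * (C * Real.exp (z ^ 2 / 4)) := by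
        gcongr
        · linarith
        · exact abs_comp_sqrt_mul_le hf ht hbt z
    _ = _ := by ring

theorem integrable_comp_sqrt_mul (hm : Measurable f) (hf : ∀ h, |f h| ≤ C * Real.exp (b * h ^ 2))
    (ht : 0 ≤ t) (hbt : 8 * b * t ≤ 1) :
    Integrable (fun z => f (Real.sqrt (2 * t) * z)) (gaussianReal 0 1) := by
  have hC : 0 ≤ C := by simpa using (abs_nonneg _).trans (hf 0)
  refine (integrable_one_add_sq_mul_exp.const_mul C).mono'
    (Measurable.aestronglyMeasurable (by fun_prop)) (ae_of_all _ fun z => ?_)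
  refine (abs_comp_sqrt_mul_le hf ht hbt z).trans (mul_le_mul_of_nonneg_left ?_ hC)
  exact le_mul_of_one_le_left (Real.exp_pos _).le (by linarith [sq_nonneg z])

theorem integrable_sq_mul_comp_sqrt_mul (hm : Measurable f)
    (hf : ∀ h, |f h| ≤ C * Real.exp (b * h ^ 2)) (ht : 0 ≤ t) (hbt : 8 * b * t ≤ 1) :
    Integrable (fun z => z ^ 2 * f (Real.sqrt (2 * t) * z)) (gaussianReal 0 1) :=
  (integrable_one_add_sq_mul_exp.const_mul C).mono'
    (Measurable.aestronglyMeasurable (by fun_prop))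
    (ae_of_all _ (abs_sq_mul_comp_sqrt_mul_le hf ht hbt))

theorem tendsto_integral_sq_mul_comp_sqrt_mul (hm : Measurable f)
    (hf : ∀ h, |f h| ≤ C * Real.exp (b * h ^ 2)) (h0 : Tendsto f (𝓝 0) (𝓝 0)) :
    Tendsto (fun t => ∫ z, z ^ 2 * f (Real.sqrt (2 * t) * z) ∂(gaussianReal 0 1)) (𝓝[>] 0)
      (𝓝 0) := by
  rw [show 𝓝 (0 : ℝ) = 𝓝 (∫ _ : ℝ, (0 : ℝ) ∂(gaussianReal 0 1)) by rw [integral_zero]]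
  refine tendsto_integral_filter_of_dominated_convergence _
    (.of_forall fun t => Measurable.aestronglyMeasurable (by fun_prop)) ?_
    (integrable_one_add_sq_mul_exp.const_mul C) (ae_of_all _ fun z => ?_)
  · filter_upwards [eventually_pos_and_mul_lt_one (8 * b)] with t ht
    exact ae_of_all _ (abs_sq_mul_comp_sqrt_mul_le hf ht.1.le ht.2.le)
  · have hsqrt : Tendsto (fun t : ℝ => Real.sqrt (2 * t) * z) (𝓝[>] 0) (𝓝 0) :=
      (Continuous.tendsto' (by fun_prop) 0 0 (by simp)).mono_left nhdsWithin_le_nhds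
    simpa using (h0.comp hsqrt).const_mul (z ^ 2)

end Rescaling

/-- The remainder of the second order Taylor expansion of `ψ` at `x` with derivatives `d₁` and
`d₂`, divided by `h²`; at `h = 0` it takes the value `0`. -/
def taylorRem (ψ : ℝ → ℝ) (d₁ d₂ x h : ℝ) : ℝ :=
  (ψ (x + h) - ψ x - d₁ * h - d₂ / 2 * h ^ 2) / h ^ 2

theorem eq_add_sq_mul_taylorRem (ψ : ℝ → ℝ) (d₁ d₂ x h : ℝ) :
    ψ (x + h) = ψ x + d₁ * h + d₂ / 2 * h ^ 2 + h ^ 2 * taylorRem ψ d₁ d₂ x h := by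
  rcases eq_or_ne h 0 with rfl | hh
  · simp
  · rw [taylorRem]; field_simp; ring

theorem measurable_taylorRem {ψ : ℝ → ℝ} (hm : Measurable ψ) (d₁ d₂ x : ℝ) :
    Measurable (taylorRem ψ d₁ d₂ x) := by
  unfold taylorRem; fun_prop

theorem tendsto_taylorRem {ψ ψ' : ℝ → ℝ} {d₂ x : ℝ} (h1 : ∀ᶠ y in 𝓝 x, HasDerivAt ψ (ψ' y) y)
    (h2 : HasDerivAt ψ' d₂ x) : Tendsto (taylorRem ψ (ψ' x) d₂ x) (𝓝 0) (𝓝 0) := by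
  have hshift : Tendsto (fun h : ℝ => x + h) (𝓝 0) (𝓝 x) :=
    Continuous.tendsto' (by fun_prop) 0 x (by simp)
  have hnum : ∀ᶠ h in 𝓝 0, HasDerivAt (fun h => ψ (x + h) - ψ x - ψ' x * h - d₂ / 2 * h ^ 2)
      (ψ' (x + h) - ψ' x - d₂ * h) h := by
    filter_upwards [hshift.eventually h1] with h hh
    refine ((((hh.comp_const_add x h).sub_const (ψ x)).sub ((hasDerivAt_id h).const_mul _)).sub
      (((hasDerivAt_id h).pow 2).const_mul (d₂ / 2))).congr_deriv ?_
    simp; ring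
  have hden : ∀ h : ℝ, HasDerivAt (fun h => h ^ 2) (2 * h) h := fun h => by
    simpa using hasDerivAt_pow 2 h
  have hquot : Tendsto (fun h => (ψ' (x + h) - ψ' x - d₂ * h) / (2 * h)) (𝓝[≠] 0) (𝓝 0) := by
    have hslope := ((hasDerivAt_iff_tendsto_slope_zero.1 h2).sub_const d₂).div_const 2
    rw [sub_self, zero_div] at hslope
    refine hslope.congr' ?_
    filter_upwards [self_mem_nhdsWithin] with h hh
    have : h ≠ 0 := hh
    simp only [smul_eq_mul]; field_simp
  have hpunctured : Tendsto (taylorRem ψ (ψ' x) d₂ x) (𝓝[≠] 0) (𝓝 0) := by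
    refine HasDerivAt.lhopital_zero_nhdsNE (hnum.filter_mono nhdsWithin_le_nhds)
      (.of_forall hden) ?_ ?_ ?_ hquot
    · filter_upwards [self_mem_nhdsWithin] with h hh
      simpa using hh
    · simpa using hnum.self_of_nhds.continuousAt.tendsto.mono_left
        (nhdsWithin_le_nhds (s := {0}ᶜ))
    · simpa using (hden 0).continuousAt.tendsto.mono_left (nhdsWithin_le_nhds (s := {0}ᶜ))
  have hzero : taylorRem ψ (ψ' x) d₂ x 0 = 0 := by simp [taylorRem]
  have hcont : ContinuousAt (taylorRem ψ (ψ' x) d₂ x) 0 :=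
    continuousWithinAt_compl_self.1 (by rwa [ContinuousWithinAt, hzero])
  rwa [ContinuousAt, hzero] at hcont

theorem lineFlow_eq_taylor {ψ : ℝ → ℝ} (hm : Measurable ψ) {d₁ d₂ x C b t : ℝ}
    (hC : ∀ h, |taylorRem ψ d₁ d₂ x h| ≤ C * Real.exp (b * h ^ 2)) (ht : 0 ≤ t)
    (hbt : 8 * b * t ≤ 1) :
    lineFlow ψ t x = ψ x + t * d₂ +
      2 * t * ∫ z, z ^ 2 * taylorRem ψ d₁ d₂ x (Real.sqrt (2 * t) * z) ∂(gaussianReal 0 1) := by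
  have hexpand : ∀ z, ψ (x + Real.sqrt (2 * t) * z) = ψ x + d₁ * Real.sqrt (2 * t) * z +
      t * d₂ * z ^ 2 + 2 * t * (z ^ 2 * taylorRem ψ d₁ d₂ x (Real.sqrt (2 * t) * z)) := fun z => by
    rw [eq_add_sq_mul_taylorRem ψ d₁ d₂ x, mul_pow, Real.sq_sqrt (by linarith)]
    ring
  have hid : Integrable (fun z => d₁ * Real.sqrt (2 * t) * z) (gaussianReal 0 1) :=
    ((memLp_id_gaussianReal 1).integrable le_rfl).const_mul _
  have hsq : Integrable (fun z => t * d₂ * z ^ 2) (gaussianReal 0 1) :=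
    (memLp_id_gaussianReal 2).integrable_sq.const_mul _
  have hlin : Integrable (fun z => ψ x + d₁ * Real.sqrt (2 * t) * z) (gaussianReal 0 1) :=
    (integrable_const _).add hid
  have hquad : Integrable (fun z => ψ x + d₁ * Real.sqrt (2 * t) * z + t * d₂ * z ^ 2)
      (gaussianReal 0 1) := hlin.add hsq
  have hrem := integrable_sq_mul_comp_sqrt_mul (measurable_taylorRem hm _ _ _) hC ht hbt
  rw [lineFlow_eq_integral_sqrt hm ht]
  simp only [hexpand]
  rw [integral_add hquad (hrem.const_mul _), integral_add hlin hsq,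
    integral_add (integrable_const _) hid, integral_const_mul, integral_const_mul,
    integral_const_mul, integral_sq_gaussianReal, integral_id_gaussianReal]
  simp

section ExpGrowth

variable {ψ : ℝ → ℝ} {M B : ℝ}

theorem abs_add_le_of_exp_growth (hB : 0 ≤ B) (hψ : ∀ y, |ψ y| ≤ M * Real.exp (B * y ^ 2))
    (x h : ℝ) : |ψ (x + h)| ≤ M * Real.exp (2 * B * x ^ 2) * Real.exp (2 * B * h ^ 2) := by
  have hM : 0 ≤ M := by simpa using (abs_nonneg _).trans (hψ 0)
  refine (hψ _).trans ?_
  rw [mul_assoc, ← Real.exp_add]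
  gcongr
  nlinarith [mul_nonneg hB (sq_nonneg (x - h))]

theorem exists_taylorRem_le (hB : 0 ≤ B) (hψ : ∀ y, |ψ y| ≤ M * Real.exp (B * y ^ 2))
    {d₁ d₂ x : ℝ} (h0 : Tendsto (taylorRem ψ d₁ d₂ x) (𝓝 0) (𝓝 0)) :
    ∃ C, ∀ h, |taylorRem ψ d₁ d₂ x h| ≤ C * Real.exp (2 * B * h ^ 2) := by
  have hM : 0 ≤ M := by simpa using (abs_nonneg _).trans (hψ 0)
  obtain ⟨δ, hδ, hnear⟩ := Metric.eventually_nhds_iff.1 (Metric.tendsto_nhds.1 h0 1 one_pos)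
  set M' := M * Real.exp (2 * B * x ^ 2)
  set K := |ψ x| / δ ^ 2 + |d₁| / δ + |d₂| / 2 with hK
  have hK0 : 0 ≤ K := by positivity
  have hM'0 : 0 ≤ M' / δ ^ 2 := by positivity
  refine ⟨1 + M' / δ ^ 2 + K, fun h => ?_⟩
  have hexp : 1 ≤ Real.exp (2 * B * h ^ 2) := Real.one_le_exp (by positivity)
  rcases lt_or_ge |h| δ with hh | hh
  · have hone : |taylorRem ψ d₁ d₂ x h| < 1 := by simpa using hnear (y := h) (by simpa using hh)
    nlinarith
  · have hδh : δ ^ 2 ≤ h ^ 2 := by rw [← sq_abs h]; gcongr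
    have hh0 : h ≠ 0 := abs_pos.1 (hδ.trans_le hh)
    calc |taylorRem ψ d₁ d₂ x h|
        = |ψ (x + h) / h ^ 2 - ψ x / h ^ 2 - d₁ / h - d₂ / 2| := by
          rw [taylorRem]; congr 1; field_simp
      _ ≤ |ψ (x + h)| / h ^ 2 + |ψ x| / h ^ 2 + |d₁| / |h| + |d₂| / 2 := by
          refine (abs_sub _ _).trans (add_le_add ((abs_sub _ _).trans
            (add_le_add ((abs_sub _ _).trans (add_le_add ?_ ?_)) ?_)) ?_) <;>
          simp [abs_div]
      _ ≤ M' * Real.exp (2 * B * h ^ 2) / δ ^ 2 + |ψ x| / δ ^ 2 + |d₁| / δ + |d₂| / 2 := by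
          gcongr
          exact abs_add_le_of_exp_growth hB hψ x h
      _ = M' / δ ^ 2 * Real.exp (2 * B * h ^ 2) + K := by rw [hK]; ring
      _ ≤ (1 + M' / δ ^ 2 + K) * Real.exp (2 * B * h ^ 2) := by nlinarith

theorem hasDerivWithinAt_lineFlow_zero (hm : Measurable ψ) (hB : 0 ≤ B)
    (hψ : ∀ y, |ψ y| ≤ M * Real.exp (B * y ^ 2)) {ψ' : ℝ → ℝ} {d₂ x : ℝ}
    (h1 : ∀ᶠ y in 𝓝 x, HasDerivAt ψ (ψ' y) y) (h2 : HasDerivAt ψ' d₂ x) :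
    HasDerivWithinAt (fun t => lineFlow ψ t x) d₂ (Ioi 0) 0 := by
  have hrem := tendsto_taylorRem h1 h2
  obtain ⟨C, hC⟩ := exists_taylorRem_le hB hψ hrem
  have hlim := ((tendsto_integral_sq_mul_comp_sqrt_mul (measurable_taylorRem hm _ _ _) hC
    hrem).const_mul 2).const_add d₂
  rw [mul_zero, add_zero] at hlim
  rw [hasDerivWithinAt_iff_tendsto_slope' (by simp)]
  refine hlim.congr' ?_
  filter_upwards [eventually_pos_and_mul_lt_one (8 * (2 * B))] with t ⟨ht, hBt⟩
  rw [slope_def_field, lineFlow_eq_taylor hm hC ht.le hBt.le, lineFlow_zero hm, sub_zero,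
    eq_div_iff ht.ne']
  ring

theorem integrable_lineFlow_of_exp_growth (hm : Measurable ψ) (hB : 0 ≤ B)
    (hψ : ∀ y, |ψ y| ≤ M * Real.exp (B * y ^ 2)) {t : ℝ} (ht : 0 ≤ t) (hBt : 16 * B * t ≤ 1)
    (x : ℝ) : Integrable (fun z => ψ (x + z)) (heatMeasure t) := by
  rw [heatMeasure_eq_map ht, integrable_map_measure
    (Measurable.aestronglyMeasurable (by fun_prop)) (by fun_prop)]
  exact integrable_comp_sqrt_mul (f := fun h => ψ (x + h)) (by fun_prop)
    (abs_add_le_of_exp_growth hB hψ x) ht (by linarith)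

theorem ofReal_lt_existenceTime_comp_eval (hm : Measurable ψ) (hB : 0 < B)
    (hψ : ∀ y, |ψ y| ≤ M * Real.exp (B * y ^ 2)) {n : ℕ} (i : Fin n) {t : ℝ}
    (hBt : 16 * B * t < 1) : ENNReal.ofReal t < existenceTime fun x : E n => ψ (x i) := by
  have hpos : 0 < 1 / (16 * B) := by positivity
  refine ((ENNReal.ofReal_lt_ofReal_iff hpos).2 ?_).trans_le <| le_sSup fun s hs hsT x => ?_
  · rwa [lt_div_iff₀' (by positivity)]
  · have hBs : 16 * B * s < 1 := by
      rwa [ENNReal.ofReal_lt_ofReal_iff hpos, lt_div_iff₀' (by positivity)] at hsT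
    rw [integrable_gaussKernel_iff hs]
    exact (measurePreserving_eval (fun _ : Fin n => heatMeasure s) i).integrable_comp_of_integrable
      (integrable_lineFlow_of_exp_growth hm hB.le hψ hs.le hBs.le (x i))

end ExpGrowth

theorem heatFlow_comp_eval {n : ℕ} (i : Fin n) {ψ : ℝ → ℝ} (hm : Measurable ψ) {t : ℝ}
    (ht : 0 < t) (x : E n) : heatFlow (fun y : E n => ψ (y i)) t x = lineFlow ψ t (x i) := by
  have hp := measurePreserving_eval (fun _ : Fin n => heatMeasure t) i
  rw [heatFlow_eq_integral ht, lineFlow, ← hp.map_eq, integral_map hp.measurable.aemeasurable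
    (Measurable.aestronglyMeasurable (by fun_prop))]
  rfl

/-! ### Test functions and necessity -/

/-- The profile `s ↦ f_F(max(s, F(a)))`. The functions `x ↦ rampProfile F a (x i)` are the
simplest nonconstant `F`-convex functions bounded from below. -/
def rampProfile (F : ℝ → ℝ) (a s : ℝ) : ℝ := inverse F (max s (F a))

section Ramp

variable {F : ℝ → ℝ} (hF : Admissible F) (htop : Tendsto F atTop atTop)
include hF htop

theorem Admissible.apply_rampProfile (a s : ℝ) : F (rampProfile F a s) = max s (F a) :=
  apply_inverse (hF.mem_imageSet_of_le htop (le_max_right _ _))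

theorem Admissible.le_rampProfile (a s : ℝ) : a ≤ rampProfile F a s :=
  hF.le_inverse htop (le_max_right _ _)

theorem Admissible.continuous_rampProfile (a : ℝ) : Continuous (rampProfile F a) :=
  continuous_iff_continuousAt.2 fun s =>
    (hF.continuousAt_inverse (hF.mem_imageSet_of_le htop (le_max_right _ _))).comp
      (f := fun s => max s (F a)) (by fun_prop)

theorem Admissible.lineFlow_rampProfile_zero {a r : ℝ} (har : a ≤ r) :
    lineFlow (rampProfile F a) 0 (F r) = r := by
  rw [lineFlow_zero (hF.continuous_rampProfile htop a).measurable, rampProfile,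
    max_eq_left (hF.strictMono.monotone har), hF.inverse_apply]

theorem Admissible.fConvex_rampProfile (a : ℝ) {n : ℕ} (i : Fin n) :
    FConvex F fun x : E n => rampProfile F a (x i) := by
  simp only [FConvex, hF.apply_rampProfile htop]
  exact ((EuclideanSpace.proj i : E n →L[ℝ] ℝ).toLinearMap.convexOn convex_univ).sup
    (convexOn_const _ convex_univ)

theorem Admissible.ofReal_exp_mul_inverse_le_gaussIntegral {A z : ℝ} (hA : 0 ≤ A)
    (hz : F 1 ≤ z) :
    ENNReal.ofReal (Real.exp (-(2 * A * z ^ 2 + 2 * A)) * inverse F z) ≤ gaussIntegral F A := by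
  have hone : 1 ≤ inverse F z := hF.le_inverse htop hz
  calc ENNReal.ofReal (Real.exp (-(2 * A * z ^ 2 + 2 * A)) * inverse F z)
      = ∫⁻ _ in Icc z (z + 1),
          ENNReal.ofReal (Real.exp (-(2 * A * z ^ 2 + 2 * A)) * inverse F z) := by
        rw [setLIntegral_const, Real.volume_Icc]; simp
    _ ≤ ∫⁻ y in Icc z (z + 1), ENNReal.ofReal (Real.exp (-A * y ^ 2) * inverse F y) := by
        refine setLIntegral_mono' measurableSet_Icc fun y hy => ENNReal.ofReal_le_ofReal ?_
        have hmono := hF.inverse_le_inverse (hF.mem_imageSet_of_le htop hz)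
          (hF.mem_imageSet_of_le htop (hz.trans hy.1)) hy.1
        have hsq : y ^ 2 ≤ 2 * z ^ 2 + 2 := by
          nlinarith [sq_nonneg (2 * z - y), mul_nonneg (sub_nonneg.2 hy.1) (sub_nonneg.2 hy.2)]
        refine mul_le_mul (Real.exp_le_exp.2 ?_) hmono (by linarith) (Real.exp_pos _).le
        nlinarith
    _ ≤ gaussIntegral F A := lintegral_mono_set fun y hy => hz.trans hy.1

variable {A : ℝ} (hA : 0 < A) (hI : gaussIntegral F A < ⊤)
include hA hI

theorem Admissible.inverse_le_exp {z : ℝ} (hz : F 1 ≤ z) :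
    inverse F z ≤ (gaussIntegral F A).toReal * Real.exp (2 * A * z ^ 2 + 2 * A) := by
  have hle := (ENNReal.ofReal_le_iff_le_toReal hI.ne).1
    (hF.ofReal_exp_mul_inverse_le_gaussIntegral htop hA.le hz)
  rwa [Real.exp_neg, inv_mul_le_iff₀' (Real.exp_pos _)] at hle

theorem Admissible.exists_rampProfile_le (a : ℝ) :
    ∃ M, ∀ s, |rampProfile F a s| ≤ M * Real.exp (2 * A * s ^ 2) := by
  set I := (gaussIntegral F A).toReal
  have hI0 : 0 ≤ I := ENNReal.toReal_nonneg
  set c := max (F a) (F 1)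
  refine ⟨|a| + I * Real.exp (2 * A * c ^ 2 + 2 * A), fun s => ?_⟩
  have hF1 : F 1 ≤ max s c := (le_max_right _ _).trans (le_max_right _ _)
  have hupper : rampProfile F a s ≤
      I * Real.exp (2 * A * c ^ 2 + 2 * A) * Real.exp (2 * A * s ^ 2) := by
    have hsq : max s c ^ 2 ≤ s ^ 2 + c ^ 2 := by
      rcases max_choice s c with h | h <;> rw [h] <;> nlinarith [sq_nonneg s, sq_nonneg c]
    calc rampProfile F a s ≤ inverse F (max s c) := hF.inverse_le_inverse
          (hF.mem_imageSet_of_le htop (le_max_right _ _)) (hF.mem_imageSet_of_le htop hF1)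
          (max_le_max le_rfl (le_max_left _ _))
      _ ≤ I * Real.exp (2 * A * max s c ^ 2 + 2 * A) := hF.inverse_le_exp htop hA hI hF1
      _ ≤ I * Real.exp (2 * A * c ^ 2 + 2 * A + 2 * A * s ^ 2) := by
          refine mul_le_mul_of_nonneg_left (Real.exp_le_exp.2 ?_) hI0
          nlinarith
      _ = _ := by rw [Real.exp_add _ (2 * A * s ^ 2)]; ring
  have hlower := hF.le_rampProfile htop a s
  have ha : |a| ≤ |a| * Real.exp (2 * A * s ^ 2) :=
    le_mul_of_one_le_right (abs_nonneg _) (Real.one_le_exp (by positivity))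
  have hupper0 : 0 ≤ I * Real.exp (2 * A * c ^ 2 + 2 * A) * Real.exp (2 * A * s ^ 2) := by
    positivity
  rw [add_mul]
  exact abs_le.2 ⟨by linarith [neg_abs_le a], by linarith [abs_nonneg a]⟩

theorem Preserved.convexOn_lineFlow_rampProfile {n : ℕ} (hn : 1 ≤ n) (hP : Preserved n F)
    (a : ℝ) {t : ℝ} (ht : 0 < t) (hAt : 16 * (2 * A) * t < 1) :
    ConvexOn ℝ univ fun s => F (lineFlow (rampProfile F a) t s) := by
  have hm : Measurable (rampProfile F a) := (hF.continuous_rampProfile htop a).measurable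
  obtain ⟨M, hM⟩ := hF.exists_rampProfile_le htop hA hI a
  let i : Fin n := ⟨0, hn⟩
  have htT := ofReal_lt_existenceTime_comp_eval hm (by positivity) hM i hAt
  have hconv : FConvex F (heatFlow (fun x : E n => rampProfile F a (x i)) t) :=
    hP _ ⟨a, forall_mem_range.2 fun x => hF.le_rampProfile htop a _⟩
      (hF.fConvex_rampProfile htop a i) (pos_of_gt htT) t ht htT
  simp only [FConvex, heatFlow_comp_eval i hm ht] at hconv
  simpa [Function.comp_def] using
    hconv.comp_linearMap (LinearMap.toSpanSingleton ℝ (E n) (EuclideanSpace.single i 1))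

end Ramp

theorem Admissible.eventually_hasDerivAt_rampProfile {F : ℝ → ℝ} (hF : Admissible F)
    (h2 : ContDiff ℝ 2 F) {a r : ℝ} (har : a < r) (hr : 0 < deriv F r) :
    ∀ᶠ z in 𝓝 (F r), HasDerivAt (rampProfile F a) (deriv F (inverse F z))⁻¹ z := by
  filter_upwards [lt_mem_nhds (hF.strictMono har), hF.eventually_hasDerivAt_inverse h2 hr]
    with z hz hd
  refine hd.congr_of_eventuallyEq ?_
  filter_upwards [lt_mem_nhds hz] with y hy
  rw [rampProfile, max_eq_left hy.le]

theorem Admissible.hasDerivWithinAt_apply_lineFlow_rampProfile {F : ℝ → ℝ} (hF : Admissible F)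
    (h2 : ContDiff ℝ 2 F) (htop : Tendsto F atTop atTop) {A : ℝ} (hA : 0 < A)
    (hI : gaussIntegral F A < ⊤) {a r : ℝ} (har : a < r) (hr : 0 < deriv F r) :
    HasDerivWithinAt (fun t => F (lineFlow (rampProfile F a) t (F r))) (gradCoeff F r)
      (Ioi 0) 0 := by
  obtain ⟨M, hM⟩ := hF.exists_rampProfile_le htop hA hI a
  have hflow := hasDerivWithinAt_lineFlow_zero (hF.continuous_rampProfile htop a).measurable
    (by positivity) hM (hF.eventually_hasDerivAt_rampProfile h2 har hr)
    ((hF.hasDerivAt_deriv_comp_inverse h2 hr).fun_inv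
      (by simpa only [hF.inverse_apply] using hr.ne'))
  have hdF : HasDerivAt F (deriv F r) (lineFlow (rampProfile F a) 0 (F r)) := by
    rw [hF.lineFlow_rampProfile_zero htop har.le]
    exact (h2.differentiable two_ne_zero r).hasDerivAt
  refine (hdF.comp_hasDerivWithinAt (0 : ℝ) hflow).congr_deriv ?_
  rw [hF.inverse_apply, gradCoeff]
  field_simp

theorem le_of_hasDerivWithinAt_Ioi {u v : ℝ → ℝ} {u' v' x : ℝ}
    (hu : HasDerivWithinAt u u' (Ioi x) x) (hv : HasDerivWithinAt v v' (Ioi x) x)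
    (hx : v x ≤ u x) (h : ∀ᶠ t in 𝓝[>] x, u t ≤ v t) : u' ≤ v' := by
  rw [hasDerivWithinAt_iff_tendsto_slope' self_notMem_Ioi] at hu hv
  refine le_of_tendsto_of_tendsto hu hv ?_
  filter_upwards [h, self_mem_nhdsWithin] with t ht hxt
  rw [slope_def_field, slope_def_field]
  exact div_le_div_of_nonneg_right (by linarith) (sub_nonneg.2 (mem_Ioi.1 hxt).le)

theorem Preserved.convexOn_logDerivInverse {n : ℕ} (hn : 1 ≤ n) {F : ℝ → ℝ}
    (hF : Admissible F) (h2 : ContDiff ℝ 2 F) (htop : Tendsto F atTop atTop) {A : ℝ} (hA : 0 < A)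
    (hI : gaussIntegral F A < ⊤) (hP : Preserved n F) {S : Set ℝ} (hS : Convex ℝ S)
    (hSJ : S ⊆ imageSet F) (hpos : ∀ r, F r ∈ S → 0 < deriv F r) :
    ConvexOn ℝ S (logDerivInverse F) := by
  refine ⟨hS, fun z₀ hz₀ z₁ hz₁ l m hl hm hlm => ?_⟩
  have hz := hS hz₀ hz₁ hl hm hlm
  obtain ⟨r₀, rfl⟩ := hSJ hz₀
  obtain ⟨r₁, rfl⟩ := hSJ hz₁
  obtain ⟨r, hr⟩ := hSJ hz
  rw [← hr] at hz ⊢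
  obtain ⟨a, ha⟩ := exists_lt (min r (min r₀ r₁))
  obtain ⟨har, har₀, har₁⟩ : a < r ∧ a < r₀ ∧ a < r₁ := by simpa only [lt_min_iff] using ha
  rw [hF.logDerivInverse_apply h2 (hpos _ hz₀), hF.logDerivInverse_apply h2 (hpos _ hz₁),
    hF.logDerivInverse_apply h2 (hpos _ hz)]
  have hder := fun {s : ℝ} (has : a < s) (hs : F s ∈ S) =>
    hF.hasDerivWithinAt_apply_lineFlow_rampProfile h2 htop hA hI has (hpos s hs)
  refine le_of_hasDerivWithinAt_Ioi (hder har hz)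
    (((hder har₀ hz₀).const_mul l).add ((hder har₁ hz₁).const_mul m)) ?_ ?_
  · simp only [Pi.add_apply, hF.lineFlow_rampProfile_zero htop, har.le, har₀.le, har₁.le]
    exact hr.ge
  · filter_upwards [eventually_pos_and_mul_lt_one (16 * (2 * A))] with t ⟨ht, hAt⟩
    rw [hr]
    exact (hP.convexOn_lineFlow_rampProfile hF htop hA hI hn a ht hAt).2
      (mem_univ (F r₀)) (mem_univ (F r₁)) hl hm hlm

theorem exists_affine_le_of_mem_interior {s : Set ℝ} {g : ℝ → ℝ} (hg : ConvexOn ℝ s g) {c : ℝ}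
    (hc : c ∈ interior s) : ∃ D, ∀ z ∈ s, g c + D * (z - c) ≤ g z := by
  refine ⟨derivWithin g (Ioi c) c, fun z hz => ?_⟩
  rcases lt_trichotomy z c with hzc | rfl | hcz
  · have hslope := (hg.slope_le_leftDeriv_of_mem_interior hz hc hzc).trans
      (hg.leftDeriv_le_rightDeriv_of_mem_interior hc)
    rw [slope_def_field, div_le_iff₀ (sub_pos.2 hzc)] at hslope
    linarith
  · simp
  · have hslope := hg.rightDeriv_le_slope_of_mem_interior hc hz hcz
    rw [slope_def_field, le_div_iff₀ (sub_pos.2 hcz)] at hslope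
    linarith

theorem bddBelow_image_of_convexOn {s : Set ℝ} {g : ℝ → ℝ} (hg : ConvexOn ℝ s g)
    (hs : Bornology.IsBounded s) (hint : (interior s).Nonempty) : BddBelow (g '' s) := by
  obtain ⟨c, hc⟩ := hint
  obtain ⟨R, hR⟩ := hs.subset_closedBall c
  obtain ⟨D, hD⟩ := exists_affine_le_of_mem_interior hg hc
  refine ⟨g c - |D| * R, forall_mem_image.2 fun z hz => ?_⟩
  have hdist : |z - c| ≤ R := hR hz
  have hslope : |D * (z - c)| ≤ |D| * R := by
    rw [abs_mul]
    gcongr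
  linarith [neg_le_of_abs_le hslope, hD z hz]

theorem bddAbove_image_Ioc_of_hasDerivAt {H g : ℝ → ℝ} {a b : ℝ}
    (hH : ∀ z ∈ Ioc a b, HasDerivAt H (g z) z) (hg : BddBelow (g '' Ioc a b)) :
    BddAbove (H '' Ioc a b) := by
  obtain ⟨C, hC⟩ := hg
  refine ⟨H b + |C| * (b - a), forall_mem_image.2 fun z hz => ?_⟩
  have hmv := (convex_Ioc a b).mul_sub_le_image_sub_of_le_deriv (f := H) (C := C)
    (fun y hy => (hH y hy).continuousAt.continuousWithinAt)
    (fun y hy => (hH y (interior_subset hy)).differentiableAt.differentiableWithinAt)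
    (fun y hy => (hC (mem_image_of_mem g (interior_subset hy))).trans_eq
      (hH y (interior_subset hy)).deriv.symm)
    z hz b ⟨hz.1.trans_le hz.2, le_rfl⟩ hz.2
  have hdrop : -(C * (b - z)) ≤ |C| * (b - a) := by
    rw [← neg_mul]
    exact mul_le_mul (neg_le_abs C) (by linarith [hz.1]) (sub_nonneg.2 hz.2) (abs_nonneg C)
  linarith

/-- If `F'(α) = 0` then `log f_F'` tends to `∞` at `F(α)` from the right, but its derivative `g_F`
is bounded below. -/
theorem Admissible.deriv_ne_zero_of_convexOn {F : ℝ → ℝ} (hF : Admissible F)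
    (h2 : ContDiff ℝ 2 F) {α β : ℝ} (hαβ : α < β) (hpos : ∀ r ∈ Ioc α β, 0 < deriv F r)
    (hconv : ConvexOn ℝ (Ioc (F α) (F β)) (logDerivInverse F)) : deriv F α ≠ 0 := by
  have hFαβ : F α < F β := hF.strictMono hαβ
  have hbelow : BddBelow (logDerivInverse F '' Ioc (F α) (F β)) :=
    bddBelow_image_of_convexOn hconv (Metric.isBounded_Ioc _ _)
      (by rw [interior_Ioc]; exact nonempty_Ioo.2 hFαβ)
  have hderiv : ∀ z ∈ Ioc (F α) (F β),
      HasDerivAt (fun z => Real.log (deriv (inverse F) z)) (logDerivInverse F z) z := by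
    intro z hz
    obtain ⟨r, rfl⟩ := hF.mem_imageSet_of_mem_Icc ⟨hz.1.le, hz.2⟩
    have hr := hpos r ⟨hF.strictMono.lt_iff_lt.1 hz.1, hF.strictMono.le_iff_le.1 hz.2⟩
    rw [hF.logDerivInverse_apply h2 hr]
    exact hF.hasDerivAt_log_deriv_inverse h2 hr
  obtain ⟨K, hK⟩ := bddAbove_image_Ioc_of_hasDerivAt hderiv hbelow
  have hlower : ∀ r ∈ Ioc α β, Real.exp (-K) ≤ deriv F r := by
    intro r hr
    have hlog := hK (mem_image_of_mem _
      ⟨hF.strictMono hr.1, hF.strictMono.monotone hr.2⟩ : _ ∈ _ '' Ioc (F α) (F β))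
    simp only [(hF.hasDerivAt_inverse (h2.differentiable two_ne_zero r) (hpos r hr).ne').deriv,
      Real.log_inv] at hlog
    rw [← Real.le_log_iff_exp_le (hpos r hr)]
    exact neg_le.1 hlog
  have hlim : Real.exp (-K) ≤ deriv F α :=
    ge_of_tendsto (((h2.continuous_deriv one_le_two).tendsto α).mono_left nhdsWithin_le_nhds)
      (eventually_of_mem (Ioc_mem_nhdsGT hαβ) hlower)
  exact ((Real.exp_pos _).trans_le hlim).ne'

theorem Preserved.deriv_pos {n : ℕ} (hn : 1 ≤ n) {F : ℝ → ℝ}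
    (hF : Admissible F) (h2 : ContDiff ℝ 2 F) (htop : Tendsto F atTop atTop) {A : ℝ} (hA : 0 < A)
    (hI : gaussIntegral F A < ⊤) (hP : Preserved n F) (r : ℝ) : 0 < deriv F r := by
  have hnonneg : ∀ r, 0 ≤ deriv F r := fun r => hF.strictMono.monotone.deriv_nonneg
  refine lt_of_le_of_ne (hnonneg r) fun h0 => ?_
  obtain ⟨β, hβ, hslope⟩ := exists_deriv_eq_slope F (lt_add_one r) hF.continuous.continuousOn
    (h2.differentiable two_ne_zero).differentiableOn
  have hβpos : 0 < deriv F β := by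
    rw [hslope]
    exact div_pos (sub_pos.2 (hF.strictMono (lt_add_one r))) (by linarith)
  have hclosed : IsClosed {x | deriv F x = 0} :=
    isClosed_eq (h2.continuous_deriv one_le_two) continuous_const
  obtain ⟨α, ⟨hαm, hα0⟩, hαmax⟩ := (isCompact_Icc.inter_right hclosed).exists_isGreatest
    ⟨r, left_mem_Icc.2 hβ.1.le, h0.symm⟩
  have hαβ : α < β := lt_of_le_of_ne hαm.2 (by rintro rfl; exact hβpos.ne' hα0)
  have hpos : ∀ x ∈ Ioc α β, 0 < deriv F x := fun x hx =>
    lt_of_le_of_ne (hnonneg x) fun h =>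
      not_lt.2 (hαmax ⟨⟨hαm.1.trans hx.1.le, hx.2⟩, h.symm⟩) hx.1
  refine hF.deriv_ne_zero_of_convexOn h2 hαβ hpos ?_ hα0
  refine hP.convexOn_logDerivInverse hn hF h2 htop hA hI (convex_Ioc _ _)
    (fun z hz => hF.mem_imageSet_of_mem_Icc ⟨hz.1.le, hz.2⟩) fun x hx => hpos x ?_
  exact ⟨hF.strictMono.lt_iff_lt.1 hx.1, hF.strictMono.le_iff_le.1 hx.2⟩

theorem Admissible.convex_imageSet {F : ℝ → ℝ} (hF : Admissible F) : Convex ℝ (imageSet F) :=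
  (isPreconnected_range hF.continuous).ordConnected.convex

end HeatFConvex

end

theorem theorem4p1 (n : ℕ) (hn : 1 ≤ n) (F : ℝ → ℝ) (hF : HeatFConvex.Admissible F) :
    ((∃ L : ℝ, Filter.Tendsto F Filter.atTop (nhds L)) →
      HeatFConvex.OnlyTriviallyPreserved n F) ∧
    (Filter.Tendsto F Filter.atTop Filter.atTop →
      (∀ A : ℝ, 0 < A → HeatFConvex.gaussIntegral F A = ⊤) →
      HeatFConvex.OnlyTriviallyPreserved n F) ∧
    (ContDiff ℝ 2 F → Filter.Tendsto F Filter.atTop Filter.atTop →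
      (∃ A : ℝ, 0 < A ∧ HeatFConvex.gaussIntegral F A < ⊤) →
      (HeatFConvex.Preserved n F ↔
        (∀ r : ℝ, 0 < deriv F r) ∧
          ConvexOn ℝ (HeatFConvex.imageSet F) (HeatFConvex.logDerivInverse F))) := by
  refine ⟨fun ⟨_, hL⟩ _ _ hφ _ _ => hφ.exists_eq_const_of_tendsto_nhds hF hL,
    fun htop hA _ _ hφ hT _ => hφ.exists_eq_const_of_gaussIntegral_eq_top hn hF htop hA hT, ?_⟩
  rintro h2 htop ⟨A, hA, hI⟩
  refine ⟨fun hP => ?_, fun ⟨hpos, hg⟩ => HeatFConvex.preserved_of_convexOn hF h2 htop hpos hg⟩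
  have hpos := hP.deriv_pos hn hF h2 htop hA hI
  exact ⟨hpos, hP.convexOn_logDerivInverse hn hF h2 htop hA hI hF.convex_imageSet
    Set.Subset.rfl fun r _ => hpos r⟩
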